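/- Work in ZFC. Let $\lambda$ be a limit ordinal (for example, the supremum of the critical sequence of an elementary embedding). For a set $A$ let $L_0(A)$ be the transitive closure of $A$, let $L_{\alpha+1}(A)$ be the set of all subsets of $L_\alpha(A)$ that are first-order definable over $(L_\alpha(A),\in)$ with parameters, let $L_\gamma(A)=\bigcup_{\alpha<\gamma}L_\alpha(A)$ for limit $\gamma$, and let $L(A)=\bigcup_{\alpha\in\mathrm{Ord}}L_\alpha(A)$. Put $$\Theta=\sup\{\gamma\in\mathrm{Ord} : \text{there is a surjection } f:V_{\lambda+1}\twoheadrightarrow\gamma \text{ with } f\in L(V_{\lambda+1})\}.$$ Then the following hold in $L(V_{\lambda+1})$: 1. $\Theta$ is regular: $\Theta$ is a limit ordinal, and for no $\alpha<\Theta$ is there a function $f:\alpha\to\Theta$ in $L(V_{\lambda+1})$ whose range is cofinal in $\Theta$. 2. $\mathrm{DC}_\lambda$: for every set $X$ and every function $F:X^{<\lambda}\to\mathcal P(X)\setminus\{\emptyset\}$ there is $g:\lambda\to X$ such that $g(\gamma)\in F(g\upharpoonright\gamma)$ for all $\gamma<\lambda$. (Here all quantifiers, as well as $X^{<\lambda}=\bigcup_{\gamma<\lambda}{}^{\gamma}X$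 and $\mathcal P(X)$, are interpreted in $L(V_{\lambda+1})$.) -/

import Mathlib

universe u

namespace RelConstr

/-! The universe `V` of set theory is `ZFSet.{u}`; classes are `Set ZFSet.{u}`. -/

/-! ### First-order definability over `(X, ∈)` -/

/-- The only symbol of the language of set theory: a binary relation symbol. -/
inductive MemRel : ℕ → Type
  | mem : MemRel 2

/-- The language of set theory. -/
def langSet : FirstOrder.Language.{0, 0} := ⟨fun _ => Empty, MemRel⟩

/-- The membership symbol. -/
abbrev memSymb : langSet.Relations 2 := MemRel.mem

/-- The structure `(X, ∈)` for the language of set theory. -/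
instance memStructure (X : ZFSet.{u}) : langSet.Structure {z : ZFSet.{u} // z ∈ X} where
  funMap := fun f _ => f.elim
  RelMap := fun r => match r with
    | .mem => fun v => (v 0 : ZFSet.{u}) ∈ (v 1 : ZFSet.{u})

theorem relMap_memSymb (X : ZFSet.{u}) (v : Fin 2 → {z : ZFSet.{u} // z ∈ X}) :
    FirstOrder.Language.Structure.RelMap memSymb v ↔ (v 0 : ZFSet.{u}) ∈ (v 1 : ZFSet.{u}) :=
  Iff.rfl

/-- `Def(X)`: the set of all subsets of `X` that are first-order definable over `(X, ∈)` with
parameters from `X`. -/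
def defPow (X : ZFSet.{u}) : ZFSet.{u} :=
  (ZFSet.powerset X).sep fun y =>
    (Set.univ : Set {z : ZFSet.{u} // z ∈ X}).Definable₁ langSet {z | (z : ZFSet.{u}) ∈ y}

/-! ### The constructible hierarchy over a set -/

/-- The transitive closure `A ∪ ⋃ A ∪ ⋃ ⋃ A ∪ …` of `A`. -/
noncomputable def trcl (A : ZFSet.{u}) : ZFSet.{u} :=
  ZFSet.iUnion fun n : ℕ => ZFSet.sUnion^[n] A

/-- `L_α(A)`: `L_0(A)` is the transitive closure of `A`, `L_{α+1}(A) = Def(L_α(A))`, and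
`L_γ(A) = ⋃_{α < γ} L_α(A)` for limit `γ`. -/
noncomputable def lStage (A : ZFSet.{u}) (α : Ordinal.{u}) : ZFSet.{u} :=
  Ordinal.limitRecOn α (trcl A) (fun _ X => defPow X)
    (fun γ _ ih => ZFSet.iUnion fun β : Set.Iio γ => ih β.1 β.2)

/-- The class `L(A) = ⋃_α L_α(A)`. -/
def lClass (A : ZFSet.{u}) : Set ZFSet.{u} :=
  {x | ∃ α : Ordinal.{u}, x ∈ lStage A α}

/-! ### Notions relativized to a class `M`

All quantifiers over sets are restricted to `M`. The bounded notions that are used (ordered pair,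
function, subset, restriction, von Neumann ordinal `α.toZFSet`) are absolute for transitive
classes. -/

/-- `f` is a function from `x` onto `y`. -/
def IsSurjFunc (x y f : ZFSet.{u}) : Prop :=
  ZFSet.IsFunc x y f ∧ ∀ b ∈ y, ∃ a ∈ x, ZFSet.pair a b ∈ f

/-- The ordinals `γ` for which there is a surjection of `A` onto `γ` that belongs to `M`. -/
def surjOrdinals (M : Set ZFSet.{u}) (A : ZFSet.{u}) : Set Ordinal.{u} :=
  {γ | ∃ f ∈ M, IsSurjFunc A γ.toZFSet f}

/-- `Θ_A^M = sup {γ : ∃ f : A ↠ γ, f ∈ M}`. The supremum is a true one, see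
`bddAbove_surjOrdinals`. -/
noncomputable def theta (M : Set ZFSet.{u}) (A : ZFSet.{u}) : Ordinal.{u} :=
  sSup (surjOrdinals M A)

/-- `f` is a function from the ordinal `α` to the ordinal `κ` with range cofinal in `κ`. -/
def IsCofinalFunc (α κ : Ordinal.{u}) (f : ZFSet.{u}) : Prop :=
  ZFSet.IsFunc α.toZFSet κ.toZFSet f ∧
    ∀ β < κ, ∃ ξ < α, ∃ η, β ≤ η ∧ ZFSet.pair ξ.toZFSet η.toZFSet ∈ f

/-- `M` satisfies "`κ` is regular": `κ` is a limit ordinal, and no function of `M` maps a smaller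
ordinal cofinally into `κ`. -/
def RegularIn (M : Set ZFSet.{u}) (κ : Ordinal.{u}) : Prop :=
  Order.IsSuccLimit κ ∧ ∀ α < κ, ¬ ∃ f ∈ M, IsCofinalFunc α κ f

/-- `X^{<ν}` as computed in `M`: the set of all functions `s ∈ M` from some `γ < ν` to `X`. -/
noncomputable def seqsBelow (M : Set ZFSet.{u}) (ν : Ordinal.{u}) (X : ZFSet.{u}) : ZFSet.{u} :=
  (ZFSet.powerset (ZFSet.prod ν.toZFSet X)).sep fun s =>
    s ∈ M ∧ ∃ γ < ν, ZFSet.IsFunc γ.toZFSet X s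

/-- `𝒫(X) ∖ {∅}` as computed in `M`. -/
def nonemptyPow (M : Set ZFSet.{u}) (X : ZFSet.{u}) : ZFSet.{u} :=
  (ZFSet.powerset X).sep fun Y => Y ∈ M ∧ Y ≠ ∅

/-- The restriction `g ↾ a` of a function `g` to `a`. -/
def restrict (g a : ZFSet.{u}) : ZFSet.{u} :=
  g.sep fun p => ∃ x ∈ a, ∃ y, p = ZFSet.pair x y

/-- `M` satisfies `DC_ν`: for all `X` and all `F : X^{<ν} → 𝒫(X) ∖ {∅}` there is `g : ν → X` with
`g(γ) ∈ F(g ↾ γ)` for all `γ < ν`. -/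
def DCIn (M : Set ZFSet.{u}) (ν : Ordinal.{u}) : Prop :=
  ∀ X ∈ M, ∀ F ∈ M, ZFSet.IsFunc (seqsBelow M ν X) (nonemptyPow M X) F →
    ∃ g ∈ M, ZFSet.IsFunc ν.toZFSet X g ∧
      ∀ γ < ν, ∃ y Y, ZFSet.pair γ.toZFSet y ∈ g ∧
        ZFSet.pair (restrict g γ.toZFSet) Y ∈ F ∧ y ∈ Y

/-! ### Basic facts -/

theorem lStage_zero (A : ZFSet.{u}) : lStage A 0 = trcl A := by
  simp [lStage]

theorem lStage_add_one (A : ZFSet.{u}) (α : Ordinal.{u}) :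
    lStage A (α + 1) = defPow (lStage A α) := by
  simp [lStage]

theorem lStage_limit (A : ZFSet.{u}) {γ : Ordinal.{u}} (hγ : Order.IsSuccLimit γ) :
    lStage A γ = ZFSet.iUnion fun β : Set.Iio γ => lStage A β.1 := by
  rw [lStage, Ordinal.limitRecOn_limit _ _ _ _ hγ]
  rfl

theorem subset_trcl (A : ZFSet.{u}) : A ⊆ trcl A :=
  ZFSet.subset_iUnion (fun n : ℕ => ZFSet.sUnion^[n] A) 0

theorem isTransitive_trcl (A : ZFSet.{u}) : (trcl A).IsTransitive := by
  intro y hy z hz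
  obtain ⟨n, hn⟩ := ZFSet.mem_iUnion.1 hy
  refine ZFSet.mem_iUnion.2 ⟨n + 1, ?_⟩
  rw [Function.iterate_succ_apply']
  exact ZFSet.mem_sUnion_of_mem hz hn

theorem trcl_subset {A B : ZFSet.{u}} (hB : B.IsTransitive) (h : A ⊆ B) : trcl A ⊆ B := by
  intro x hx
  obtain ⟨n, hn⟩ := ZFSet.mem_iUnion.1 hx
  clear hx
  induction n generalizing x with
  | zero => exact h hn
  | succ n ih =>
    rw [Function.iterate_succ_apply'] at hn
    obtain ⟨y, hy, hxy⟩ := ZFSet.mem_sUnion.1 hn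
    exact hB.mem_trans hxy (ih hy)

theorem bddAbove_surjOrdinals (M : Set ZFSet.{u}) (A : ZFSet.{u}) :
    BddAbove (surjOrdinals M A) := by
  refine ⟨(Order.succ A.card).ord, ?_⟩
  rintro γ ⟨f, -, hf, hs⟩
  refine le_of_lt (Cardinal.lt_ord.2 (Order.lt_succ_of_le ?_))
  rw [← Ordinal.card_toZFSet, ← Cardinal.lift_le.{u + 1}, ← ZFSet.cardinalMk_coe_sort,
    ← ZFSet.cardinalMk_coe_sort]
  choose g hg hgf using hs
  refine Cardinal.mk_le_of_injective
    (f := fun b : {z // z ∈ γ.toZFSet} => (⟨g b.1 b.2, hg b.1 b.2⟩ : {z // z ∈ A})) ?_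
  intro b c hbc
  have e : g b.1 b.2 = g c.1 c.2 := congrArg Subtype.val hbc
  have h1 := hgf b.1 b.2
  have h2 := hgf c.1 c.2
  rw [← e] at h2
  exact Subtype.ext ((hf.2 _ (hg b.1 b.2)).unique h1 h2)

end RelConstr

/-!
In `M = L(V_{λ+1})` every set is definable from an ordinal and an element of `V_{λ+1}`, by a
definition that is uniform and available in `M`. So `M` can choose up to a parameter from `V_{λ+1}`:
for a nonempty class of `M`, take the least ordinal from which some member is definable, and let the
parameter vary over `V_{λ+1}`. Both statements follow, since `λ` is a limit ordinal and hence
families of elements of `V_{λ+1}` indexed by subsets of `V_λ` are coded by elements of `V_{λ+1}`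
(`exists_slice_eq`).

*Regularity* (`regularIn_theta`). If `f : α → Θ` in `M` were cofinal with `α < Θ`, choose in this
manner surjections from `V_{λ+1}` onto the ordinals `f(ξ) + 1`. An element of `V_{λ+1}` that codes a
name for `ξ`, a parameter for the choice and an argument of the chosen surjection is mapped to an
ordinal below `Θ`, and all ordinals below `Θ` are obtained. Then `Θ`, and with it `Θ + 1`, would be
a surjective image of `V_{λ+1}` in `M`.

*Dependent choice* (`dcIn_lClass`). By the axiom of choice in the universe there is a sequence of
length `λ` of parameters that leads to a thread through `F`. The sequence is coded by an element of
`V_{λ+1}`, so it belongs to `M`, and `M` rebuilds the thread from it by recursion.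

To have the uniform definition (`isEnum_of_mem_lClass`), three things are needed.

* `M` is an inner model (`InnerClass`): it contains the subsets of its elements that are definable
  over `(M, ∈)`, by reflection (`exists_elementary_stage`), and it covers sets of its elements. Such
  classes are closed under recursion along `∈` (`DefFun.memRec`). Definability over `M` is treated
  semantically, by the classes `DefRel` and `DefFun`, whose instances do the bookkeeping.
* The stages `L_α(A)` form a definable family in `M` (`DefFun.lStage_rank`). No formulas are coded
  in `M`: the definable relations over a set are generated from atomic ones by finitely many
  operations, which are values of the one function `op`; the generation takes `ω` steps.
* The same operations, applied to tuples that consist of a stage and of objects already obtained,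
  generate from the stages and the elements of `V_{λ+1}` all elements of `M`. A definable pairing of
  ordinals makes this generation a recursion on ordinals (`enumFam`).
-/

/-! ### Definable relations and functions over a class -/

open FirstOrder FirstOrder.Language

namespace RelConstr

/-- The structure `(M, ∈)` for a class `M`. -/
instance classStructure (M : Set ZFSet.{u}) : langSet.Structure M where
  funMap := fun f _ => f.elim
  RelMap := fun r => match r with
    | .mem => fun v => (v 0 : ZFSet.{u}) ∈ (v 1 : ZFSet.{u})

theorem relMap_class (M : Set ZFSet.{u}) (v : Fin 2 → M) :
    Structure.RelMap memSymb v ↔ (v 0 : ZFSet.{u}) ∈ (v 1 : ZFSet.{u}) :=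
  Iff.rfl

/-- The relation `P` is first-order definable over `(M, ∈)` with parameters from `M`. Only the
values of `P` at tuples of elements of `M` matter. The parameters are the free variables of the
formula, and each of them is interpreted by itself. -/
class DefRel (M : Set ZFSet.{u}) {n : ℕ} (P : (Fin n → ZFSet.{u}) → Prop) : Prop where
  out : ∃ φ : langSet.BoundedFormula M n, ∀ v : Fin n → M,
    φ.Realize id v ↔ P fun i => (v i : ZFSet.{u})

/-- The function `t` maps tuples of elements of `M` to elements of `M`, and its graph is definable
over `(M, ∈)` with parameters. -/
class DefFun (M : Set ZFSet.{u}) {n : ℕ} (t : (Fin n → ZFSet.{u}) → ZFSet.{u}) : Prop where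
  maps : ∀ v, (∀ i, v i ∈ M) → t v ∈ M
  graph : DefRel M fun w : Fin (n + 1) → ZFSet.{u} => w (Fin.last n) = t fun i => w i.castSucc

variable {M : Set ZFSet.{u}} {n k : ℕ}

theorem DefRel.congr {P Q : (Fin n → ZFSet.{u}) → Prop} (hP : DefRel M P)
    (h : ∀ v, (∀ i, v i ∈ M) → (P v ↔ Q v)) : DefRel M Q := by
  obtain ⟨φ, hφ⟩ := hP.out
  exact ⟨φ, fun v => (hφ v).trans (h _ fun i => (v i).2)⟩

instance DefRel.not {P : (Fin n → ZFSet.{u}) → Prop} [hP : DefRel M P] :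
    DefRel M fun v => ¬ P v := by
  obtain ⟨φ, hφ⟩ := hP.out
  exact ⟨φ.not, fun v => by rw [BoundedFormula.realize_not, hφ]⟩

instance DefRel.imp {P Q : (Fin n → ZFSet.{u}) → Prop} [hP : DefRel M P] [hQ : DefRel M Q] :
    DefRel M fun v => P v → Q v := by
  obtain ⟨φ, hφ⟩ := hP.out
  obtain ⟨ψ, hψ⟩ := hQ.out
  exact ⟨φ.imp ψ, fun v => by rw [BoundedFormula.realize_imp, hφ, hψ]⟩

instance DefRel.and {P Q : (Fin n → ZFSet.{u}) → Prop} [hP : DefRel M P] [hQ : DefRel M Q] :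
    DefRel M fun v => P v ∧ Q v := by
  obtain ⟨φ, hφ⟩ := hP.out
  obtain ⟨ψ, hψ⟩ := hQ.out
  exact ⟨φ ⊓ ψ, fun v => by rw [BoundedFormula.realize_inf, hφ, hψ]⟩

instance DefRel.or {P Q : (Fin n → ZFSet.{u}) → Prop} [hP : DefRel M P] [hQ : DefRel M Q] :
    DefRel M fun v => P v ∨ Q v := by
  obtain ⟨φ, hφ⟩ := hP.out
  obtain ⟨ψ, hψ⟩ := hQ.out
  exact ⟨φ ⊔ ψ, fun v => by rw [BoundedFormula.realize_sup, hφ, hψ]⟩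

instance DefRel.iff {P Q : (Fin n → ZFSet.{u}) → Prop} [hP : DefRel M P] [hQ : DefRel M Q] :
    DefRel M fun v => P v ↔ Q v := by
  obtain ⟨φ, hφ⟩ := hP.out
  obtain ⟨ψ, hψ⟩ := hQ.out
  exact ⟨φ.iff ψ, fun v => by rw [BoundedFormula.realize_iff, hφ, hψ]⟩

instance (priority := low) DefRel.const {p : Prop} : DefRel M fun _ : Fin n → ZFSet.{u} => p := by
  by_cases hp : p
  · exact ⟨⊤, fun v => by simp [hp]⟩
  · exact ⟨⊥, fun v => by simp [hp]⟩

instance DefRel.existsMem {Q : (Fin n → ZFSet.{u}) → ZFSet.{u} → Prop}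
    [hQ : DefRel M fun w : Fin (n + 1) → ZFSet.{u} => Q (fun i => w i.castSucc) (w (Fin.last n))] :
    DefRel M fun v => ∃ x ∈ M, Q v x := by
  obtain ⟨φ, hφ⟩ := hQ.out
  refine ⟨φ.ex, fun v => ?_⟩
  simp [BoundedFormula.realize_ex, hφ]

instance DefRel.forallMem {Q : (Fin n → ZFSet.{u}) → ZFSet.{u} → Prop}
    [hQ : DefRel M fun w : Fin (n + 1) → ZFSet.{u} => Q (fun i => w i.castSucc) (w (Fin.last n))] :
    DefRel M fun v => ∀ x ∈ M, Q v x := by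
  obtain ⟨φ, hφ⟩ := hQ.out
  refine ⟨φ.all, fun v => ?_⟩
  simp [BoundedFormula.realize_all, hφ]

theorem DefRel.var_mem_var (i j : Fin n) : DefRel M fun v : Fin n → ZFSet.{u} => v i ∈ v j :=
  ⟨memSymb.boundedFormula₂ (Term.var (Sum.inr i)) (Term.var (Sum.inr j)), fun v => by
    rw [BoundedFormula.realize_rel₂, relMap_class]; rfl⟩

theorem DefRel.var_eq_var (i j : Fin n) : DefRel M fun v : Fin n → ZFSet.{u} => v i = v j :=
  ⟨(Term.var (Sum.inr i)).bdEqual (Term.var (Sum.inr j)), fun v => by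
    rw [BoundedFormula.realize_bdEqual]
    simp [Subtype.ext_iff]⟩

theorem DefRel.var_eq_const (i : Fin n) {c : ZFSet.{u}} (hc : c ∈ M) :
    DefRel M fun v : Fin n → ZFSet.{u} => v i = c :=
  ⟨(Term.var (Sum.inr i)).bdEqual (Term.var (Sum.inl ⟨c, hc⟩)), fun v => by
    rw [BoundedFormula.realize_bdEqual]
    simp [Subtype.ext_iff]⟩

/-- Renaming of variables. -/
theorem DefRel.rename {P : (Fin k → ZFSet.{u}) → Prop} (hP : DefRel M P) (ρ : Fin k → Fin n) :
    DefRel M fun v : Fin n → ZFSet.{u} => P fun i => v (ρ i) := by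
  obtain ⟨φ, hφ⟩ := hP.out
  refine ⟨(BoundedFormula.relabel (k := 0) (Sum.elim Sum.inl fun i => Sum.inr (ρ i))
    φ.toFormula : langSet.BoundedFormula M (n + 0)), fun v => ?_⟩
  rw [← hφ (fun i => v (ρ i))]
  erw [BoundedFormula.realize_relabel]
  have key : φ.Realize id (fun i => v (ρ i)) ↔ φ.toFormula.Realize (Sum.elim id fun i => v (ρ i)) :=
    (BoundedFormula.realize_toFormula φ (Sum.elim id fun i => v (ρ i))).symm
  rw [key, Formula.Realize]
  refine iff_of_eq ?_
  congr 1
  · ext (i | i) <;> simp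
  · ext i
    exact i.elim0

instance DefFun.var (i : Fin n) : DefFun M fun v : Fin n → ZFSet.{u} => v i :=
  ⟨fun _ hv => hv i, DefRel.var_eq_var _ _⟩

/-- `c` is an element of the class `M`; a class, so that definability of terms with the constant
`c` is found by instance search. -/
class InClass (M : Set ZFSet.{u}) (c : ZFSet.{u}) : Prop where
  mem : c ∈ M

instance (priority := low) DefFun.const {c : ZFSet.{u}} [h : InClass M c] :
    DefFun M fun _ : Fin n → ZFSet.{u} => c :=
  ⟨fun _ _ => h.mem, DefRel.var_eq_const _ h.mem⟩

theorem DefFun.rename {t : (Fin k → ZFSet.{u}) → ZFSet.{u}} (ht : DefFun M t) (ρ : Fin k → Fin n) :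
    DefFun M fun v : Fin n → ZFSet.{u} => t fun i => v (ρ i) := by
  refine ⟨fun v hv => ht.maps _ fun i => hv _, ?_⟩
  have := ht.graph.rename
    (Fin.lastCases (Fin.last n) fun i => (ρ i).castSucc : Fin (k + 1) → Fin (n + 1))
  simpa using this

/-- Substitution of a definable function for the last variable. -/
theorem DefRel.substLast {Q : (Fin n → ZFSet.{u}) → ZFSet.{u} → Prop}
    (hQ : DefRel M fun w : Fin (n + 1) → ZFSet.{u} => Q (fun i => w i.castSucc) (w (Fin.last n)))
    {t : (Fin n → ZFSet.{u}) → ZFSet.{u}} (ht : DefFun M t) : DefRel M fun v => Q v (t v) := by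
  have := ht.graph
  have : DefRel M fun v => ∃ x ∈ M, x = t v ∧ Q v x := inferInstance
  refine this.congr fun v hv => ?_
  constructor
  · rintro ⟨x, -, rfl, h⟩
    exact h
  · exact fun h => ⟨_, ht.maps v hv, rfl, h⟩

theorem DefRel.substAux : ∀ (k : ℕ) {n : ℕ} {P : (Fin n → ZFSet.{u}) → (Fin k → ZFSet.{u}) → Prop},
    (DefRel M fun w : Fin (n + k) → ZFSet.{u} =>
      P (fun i => w (Fin.castAdd k i)) (fun i => w (Fin.natAdd n i))) →
    ∀ t : Fin k → (Fin n → ZFSet.{u}) → ZFSet.{u}, (∀ i, DefFun M (t i)) →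
      DefRel M fun v => P v fun i => t i v := by
  intro k
  induction k with
  | zero =>
    intro n P h t _
    refine DefRel.congr h fun v _ => ?_
    rw [Subsingleton.elim (fun i => t i v) fun i : Fin 0 => v (Fin.natAdd n i)]
    rfl
  | succ k ih =>
    intro n P h t ht
    have h1 := ih (P := fun v x => P v (Fin.snoc x (t (Fin.last k) v)))
      (n := n) ?_ (fun i => t i.castSucc) (fun i => ht _)
    · refine DefRel.congr h1 fun v _ => iff_of_eq ?_
      congr 1
      ext i : 1
      refine Fin.lastCases ?_ (fun i => ?_) i <;> simp
    · refine DefRel.substLast (n := n + k)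
        (Q := fun w y => P (fun i => w (Fin.castAdd k i))
          (Fin.snoc (fun i => w (Fin.natAdd n i)) y))
        ?_ ((ht (Fin.last k)).rename (Fin.castAdd k))
      refine DefRel.congr h fun v _ => iff_of_eq ?_
      congr 1
      ext i : 1
      refine Fin.lastCases ?_ (fun i => ?_) i
      · simp
      · simp

/-- Substitution of definable functions for all variables. -/
theorem DefRel.comp {P : (Fin k → ZFSet.{u}) → Prop} (hP : DefRel M P)
    {t : Fin k → (Fin n → ZFSet.{u}) → ZFSet.{u}} (ht : ∀ i, DefFun M (t i)) :
    DefRel M fun v => P fun i => t i v :=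
  DefRel.substAux k (P := fun _ x => P x) (hP.rename (Fin.natAdd n)) t ht

theorem DefFun.comp {f : (Fin k → ZFSet.{u}) → ZFSet.{u}} (hf : DefFun M f)
    {t : Fin k → (Fin n → ZFSet.{u}) → ZFSet.{u}} (ht : ∀ i, DefFun M (t i)) :
    DefFun M fun v => f fun i => t i v := by
  refine ⟨fun v hv => hf.maps _ fun i => (ht i).maps v hv, ?_⟩
  have := DefRel.comp hf.graph (n := n + 1) (t := Fin.lastCases (fun w => w (Fin.last n))
    fun i w => t i fun j => w j.castSucc) (by
      intro i
      refine Fin.lastCases ?_ (fun i => ?_) i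
      · simpa using DefFun.var (Fin.last n)
      · simpa using (ht i).rename Fin.castSucc)
  simpa using this

section comp

variable {s t r q : (Fin n → ZFSet.{u}) → ZFSet.{u}}

theorem DefRel.comp₁ {R : ZFSet.{u} → Prop}
    (hR : DefRel M fun v : Fin 1 → ZFSet.{u} => R (v 0)) (hs : DefFun M s) :
    DefRel M fun v => R (s v) :=
  hR.comp (t := ![s]) (by simpa using hs)

theorem DefRel.comp₂ {R : ZFSet.{u} → ZFSet.{u} → Prop}
    (hR : DefRel M fun v : Fin 2 → ZFSet.{u} => R (v 0) (v 1)) (hs : DefFun M s)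
    (ht : DefFun M t) : DefRel M fun v => R (s v) (t v) :=
  hR.comp (t := ![s, t]) (by simpa [Fin.forall_fin_succ] using ⟨hs, ht⟩)

theorem DefRel.comp₃ {R : ZFSet.{u} → ZFSet.{u} → ZFSet.{u} → Prop}
    (hR : DefRel M fun v : Fin 3 → ZFSet.{u} => R (v 0) (v 1) (v 2)) (hs : DefFun M s)
    (ht : DefFun M t) (hr : DefFun M r) : DefRel M fun v => R (s v) (t v) (r v) :=
  hR.comp (t := ![s, t, r]) (by simpa [Fin.forall_fin_succ] using ⟨hs, ht, hr⟩)

theorem DefFun.comp₁ {f : ZFSet.{u} → ZFSet.{u}}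
    (hf : DefFun M fun v : Fin 1 → ZFSet.{u} => f (v 0)) (hs : DefFun M s) :
    DefFun M fun v => f (s v) :=
  hf.comp (t := ![s]) (by simpa using hs)

theorem DefFun.comp₂ {f : ZFSet.{u} → ZFSet.{u} → ZFSet.{u}}
    (hf : DefFun M fun v : Fin 2 → ZFSet.{u} => f (v 0) (v 1)) (hs : DefFun M s)
    (ht : DefFun M t) : DefFun M fun v => f (s v) (t v) :=
  hf.comp (t := ![s, t]) (by simpa [Fin.forall_fin_succ] using ⟨hs, ht⟩)

theorem DefFun.comp₃ {f : ZFSet.{u} → ZFSet.{u} → ZFSet.{u} → ZFSet.{u}}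
    (hf : DefFun M fun v : Fin 3 → ZFSet.{u} => f (v 0) (v 1) (v 2)) (hs : DefFun M s)
    (ht : DefFun M t) (hr : DefFun M r) : DefFun M fun v => f (s v) (t v) (r v) :=
  hf.comp (t := ![s, t, r]) (by simpa [Fin.forall_fin_succ] using ⟨hs, ht, hr⟩)

instance DefRel.mem [hs : DefFun M s] [ht : DefFun M t] : DefRel M fun v => s v ∈ t v :=
  DefRel.comp₂ (R := fun x y => x ∈ y) (DefRel.var_mem_var 0 1) hs ht

instance DefRel.eq [hs : DefFun M s] [ht : DefFun M t] : DefRel M fun v => s v = t v :=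
  DefRel.comp₂ (R := fun x y => x = y) (DefRel.var_eq_var 0 1) hs ht

end comp

/-- Fixing some variables at elements of the class. -/
theorem DefRel.fix {P : (Fin n → ZFSet.{u}) → ZFSet.{u} → Prop}
    (hP : DefRel M fun w : Fin (n + 1) → ZFSet.{u} => P (fun i => w i.castSucc) (w (Fin.last n)))
    {v : Fin n → ZFSet.{u}} (hv : ∀ i, v i ∈ M) :
    DefRel M fun w : Fin 1 → ZFSet.{u} => P v (w 0) := by
  have := DefRel.comp hP (n := 1) (t := Fin.lastCases (fun w => w 0) fun i _ => v i) (by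
    intro i
    refine Fin.lastCases ?_ (fun i => ?_) i
    · simpa using DefFun.var 0
    · have : InClass M (v i) := ⟨hv i⟩
      simpa using (inferInstance : DefFun M fun _ : Fin 1 → ZFSet.{u} => v i))
  simpa using this

end RelConstr

/-! ### Classes closed under definable subsets -/

namespace RelConstr

/-- A transitive class. -/
class TransClass (M : Set ZFSet.{u}) : Prop where
  trans : ∀ {x y : ZFSet.{u}}, x ∈ M → y ∈ x → y ∈ M

/-- A transitive class `M` that contains every subset of an element of `M` that is definable over
`(M, ∈)` and in which every set of elements of `M` is covered by an element of `M`. Such an `M`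
is an inner model of `ZF`. -/
class InnerClass (M : Set ZFSet.{u}) : Prop extends TransClass M where
  sep : ∀ {P : ZFSet.{u} → Prop}, (DefRel M fun v : Fin 1 → ZFSet.{u} => P (v 0)) →
    ∀ {X : ZFSet.{u}}, X ∈ M → X.sep P ∈ M
  cover : ∀ S : ZFSet.{u}, (∀ x ∈ S, x ∈ M) → ∃ Y ∈ M, S ⊆ Y

variable {M : Set ZFSet.{u}} {n : ℕ} {s t r q : (Fin n → ZFSet.{u}) → ZFSet.{u}}

section Trans

variable [TransClass M]

instance DefRel.existsIn [ht : DefFun M t] {Q : (Fin n → ZFSet.{u}) → ZFSet.{u} → Prop}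
    [hQ : DefRel M fun w : Fin (n + 1) → ZFSet.{u} => Q (fun i => w i.castSucc) (w (Fin.last n))] :
    DefRel M fun v => ∃ x ∈ t v, Q v x := by
  have := ht.rename (Fin.castSucc (n := n))
  have : DefRel M fun v => ∃ x ∈ M, x ∈ t v ∧ Q v x := inferInstance
  exact this.congr fun v hv => ⟨fun ⟨x, _, h⟩ => ⟨x, h⟩,
    fun ⟨x, h⟩ => ⟨x, TransClass.trans (ht.maps v hv) h.1, h⟩⟩

instance DefRel.forallIn [ht : DefFun M t] {Q : (Fin n → ZFSet.{u}) → ZFSet.{u} → Prop}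
    [hQ : DefRel M fun w : Fin (n + 1) → ZFSet.{u} => Q (fun i => w i.castSucc) (w (Fin.last n))] :
    DefRel M fun v => ∀ x ∈ t v, Q v x := by
  have := ht.rename (Fin.castSucc (n := n))
  have : DefRel M fun v => ∀ x ∈ M, x ∈ t v → Q v x := inferInstance
  exact this.congr fun v hv => ⟨fun h x hx => h x (TransClass.trans (ht.maps v hv) hx) hx,
    fun h x _ => h x⟩

instance DefRel.subset [hs : DefFun M s] [ht : DefFun M t] : DefRel M fun v => s v ⊆ t v := by
  refine DefRel.comp₂ (R := fun x y => x ⊆ y) ?_ hs ht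
  have : DefRel M fun v : Fin 2 → ZFSet.{u} => ∀ z ∈ v 0, z ∈ v 1 := inferInstance
  exact this.congr fun v _ => Iff.rfl

instance DefRel.isTransitive [hs : DefFun M s] : DefRel M fun v => (s v).IsTransitive := by
  refine DefRel.comp₁ (R := ZFSet.IsTransitive) ?_ hs
  have : DefRel M fun v : Fin 1 → ZFSet.{u} => ∀ z ∈ v 0, z ⊆ v 0 := inferInstance
  exact this.congr fun v _ => Iff.rfl

instance DefRel.isOrdinal [hs : DefFun M s] : DefRel M fun v => (s v).IsOrdinal := by
  refine DefRel.comp₁ (R := ZFSet.IsOrdinal) ?_ hs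
  have : DefRel M fun v : Fin 1 → ZFSet.{u} =>
    (v 0).IsTransitive ∧ ∀ y ∈ v 0, y.IsTransitive := inferInstance
  exact this.congr fun v _ => ZFSet.isOrdinal_iff_forall_mem_isTransitive.symm

end Trans

section Inner

variable [InnerClass M]

/-- A function whose values are sets of elements of `M` is definable as soon as the membership in
its values is. -/
theorem DefFun.of_mem {f : (Fin n → ZFSet.{u}) → ZFSet.{u}}
    (hM : ∀ v, (∀ i, v i ∈ M) → ∀ z ∈ f v, z ∈ M)
    (hD : DefRel M fun w : Fin (n + 1) → ZFSet.{u} => w (Fin.last n) ∈ f fun i => w i.castSucc) :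
    DefFun M f := by
  refine ⟨fun v hv => ?_, ?_⟩
  · obtain ⟨Y, hY, hfY⟩ := InnerClass.cover (f v) (hM v hv)
    have := InnerClass.sep (DefRel.fix (P := fun v x => x ∈ f v) hD hv) hY
    have e : Y.sep (fun x => x ∈ f v) = f v := by
      ext z
      rw [ZFSet.mem_sep]
      exact ⟨fun h => h.2, fun h => ⟨hfY h, h⟩⟩
    rwa [e] at this
  · have h := hD.rename (n := n + 2)
      (Fin.lastCases (Fin.last (n + 1)) fun i => i.castSucc.castSucc)
    have h : DefRel M fun w : Fin (n + 2) → ZFSet.{u} =>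
        w (Fin.last (n + 1)) ∈ f fun i => w i.castSucc.castSucc := by simpa using h
    have : DefRel M fun w : Fin (n + 1) → ZFSet.{u} =>
        ∀ z ∈ M, z ∈ w (Fin.last n) ↔ z ∈ f fun i => w i.castSucc :=
      DefRel.forallMem (Q := fun w z => z ∈ w (Fin.last n) ↔ z ∈ f fun i => w i.castSucc)
    refine this.congr fun w hw => ?_
    constructor
    · intro h
      ext z
      exact ⟨fun hz => (h z (TransClass.trans (hw _) hz)).1 hz,
        fun hz => (h z (hM _ (fun i => hw _) z hz)).2 hz⟩
    · intro h z _
      rw [h]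

instance : InClass M ∅ := by
  constructor
  obtain ⟨Y, hY, -⟩ := InnerClass.cover (M := M) ∅ (by simp)
  have := InnerClass.sep (M := M) (P := fun _ => False) inferInstance hY
  have e : Y.sep (fun _ => False) = ∅ := by
    ext z
    simp
  rwa [e] at this

instance DefFun.sep [ht : DefFun M t] {Q : (Fin n → ZFSet.{u}) → ZFSet.{u} → Prop}
    [hQ : DefRel M fun w : Fin (n + 1) → ZFSet.{u} => Q (fun i => w i.castSucc) (w (Fin.last n))] :
    DefFun M fun v => (t v).sep fun x => Q v x := by
  have := ht.rename (Fin.castSucc (n := n))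
  refine DefFun.of_mem (fun v hv z hz => ?_) ?_
  · exact TransClass.trans (ht.maps v hv) (ZFSet.mem_sep.1 hz).1
  · simp only [ZFSet.mem_sep]
    infer_instance

/-- The set of values of `f` on `X`. -/
noncomputable def imageOf (f : ZFSet.{u} → ZFSet.{u}) (X : ZFSet.{u}) : ZFSet.{u} :=
  ZFSet.range fun y : X => f y

@[simp]
theorem mem_imageOf {f : ZFSet.{u} → ZFSet.{u}} {X z : ZFSet.{u}} :
    z ∈ imageOf f X ↔ ∃ y ∈ X, z = f y := by
  simp [imageOf, eq_comm]

instance DefFun.imageOf [ht : DefFun M t] {f : (Fin n → ZFSet.{u}) → ZFSet.{u} → ZFSet.{u}}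
    [hf : DefFun M fun w : Fin (n + 1) → ZFSet.{u} => f (fun i => w i.castSucc) (w (Fin.last n))] :
    DefFun M fun v => imageOf (fun x => f v x) (t v) := by
  have h1 := ht.rename (Fin.castSucc (n := n))
  refine DefFun.of_mem (fun v hv z hz => ?_) ?_
  · obtain ⟨y, hy, rfl⟩ := mem_imageOf.1 hz
    have := hf.maps (Fin.snoc v y) (by
      intro i
      refine Fin.lastCases ?_ (fun i => ?_) i
      · simpa using TransClass.trans (ht.maps v hv) hy
      · simpa using hv i)
    simpa using this
  · have h2 := hf.rename (n := n + 2)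
      (Fin.lastCases (Fin.last (n + 1)) fun i => i.castSucc.castSucc)
    have h2 : DefFun M fun w : Fin (n + 2) → ZFSet.{u} =>
        f (fun i => w i.castSucc.castSucc) (w (Fin.last (n + 1))) := by simpa using h2
    simp only [mem_imageOf]
    exact DefRel.existsIn (Q := fun w y => w (Fin.last n) = f (fun i => w i.castSucc) y)

open Classical in
instance DefFun.ite [hs : DefFun M s] [ht : DefFun M t] {P : (Fin n → ZFSet.{u}) → Prop}
    [hP : DefRel M P] : DefFun M fun v => if P v then s v else t v := by
  have h1 := hs.rename (Fin.castSucc (n := n))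
  have h2 := ht.rename (Fin.castSucc (n := n))
  have h3 := hP.rename (Fin.castSucc (n := n))
  refine DefFun.of_mem (fun v hv z hz => ?_) ?_
  · split_ifs at hz
    · exact TransClass.trans (hs.maps v hv) hz
    · exact TransClass.trans (ht.maps v hv) hz
  · have : DefRel M fun w : Fin (n + 1) → ZFSet.{u} =>
      ((P fun i => w i.castSucc) ∧ w (Fin.last n) ∈ s fun i => w i.castSucc) ∨
      (¬ (P fun i => w i.castSucc) ∧ w (Fin.last n) ∈ t fun i => w i.castSucc) := inferInstance
    refine this.congr fun v _ => ?_
    split_ifs with h <;> simp [h]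

instance DefFun.upair [hs : DefFun M s] [ht : DefFun M t] :
    DefFun M fun v => ({s v, t v} : ZFSet.{u}) := by
  refine DefFun.comp₂ (f := fun x y => {x, y}) (DefFun.of_mem (fun v hv z hz => ?_) ?_) hs ht
  · rcases ZFSet.mem_pair.1 hz with rfl | rfl <;> exact hv _
  · simp only [ZFSet.mem_pair]
    infer_instance

instance DefFun.singleton [hs : DefFun M s] : DefFun M fun v => ({s v} : ZFSet.{u}) := by
  have : DefFun M fun v => ({s v, s v} : ZFSet.{u}) := inferInstance
  simpa only [ZFSet.pair_eq_singleton] using this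

instance DefFun.pair [hs : DefFun M s] [ht : DefFun M t] :
    DefFun M fun v => ZFSet.pair (s v) (t v) := by
  unfold ZFSet.pair
  infer_instance

instance DefFun.sUnion [hs : DefFun M s] : DefFun M fun v => ZFSet.sUnion (s v) := by
  refine DefFun.comp₁ (f := ZFSet.sUnion) (DefFun.of_mem (fun v hv z hz => ?_) ?_) hs
  · obtain ⟨y, hy, hz⟩ := ZFSet.mem_sUnion.1 hz
    exact TransClass.trans (TransClass.trans (hv _) hy) hz
  · simp only [ZFSet.mem_sUnion]
    infer_instance

instance DefFun.union [hs : DefFun M s] [ht : DefFun M t] : DefFun M fun v => s v ∪ t v := by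
  simp only [← ZFSet.sUnion_pair]
  infer_instance

instance DefFun.insert [hs : DefFun M s] [ht : DefFun M t] :
    DefFun M fun v => Insert.insert (s v) (t v) := by
  simp only [ZFSet.insert_eq]
  infer_instance

instance DefFun.prod [hs : DefFun M s] [ht : DefFun M t] :
    DefFun M fun v => ZFSet.prod (s v) (t v) := by
  refine DefFun.comp₂ (f := ZFSet.prod) (DefFun.of_mem (fun v hv z hz => ?_) ?_) hs ht
  · obtain ⟨a, ha, b, hb, rfl⟩ := ZFSet.mem_prod.1 hz
    have : DefFun M fun v : Fin 2 → ZFSet.{u} => ZFSet.pair (v 0) (v 1) := inferInstance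
    exact this.maps ![a, b] (by
      simpa [Fin.forall_fin_succ] using ⟨TransClass.trans (hv 0) ha, TransClass.trans (hv 1) hb⟩)
  · simp only [ZFSet.mem_prod]
    infer_instance

theorem pair_mem_class {a b : ZFSet.{u}} (ha : a ∈ M) (hb : b ∈ M) : ZFSet.pair a b ∈ M := by
  have : DefFun M fun v : Fin 2 → ZFSet.{u} => ZFSet.pair (v 0) (v 1) := inferInstance
  exact this.maps ![a, b] (by simpa [Fin.forall_fin_succ] using ⟨ha, hb⟩)

theorem mem_class_of_pair {a b : ZFSet.{u}} (h : ZFSet.pair a b ∈ M) : a ∈ M ∧ b ∈ M := by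
  have h1 : ({a, b} : ZFSet.{u}) ∈ M := TransClass.trans h (by simp [ZFSet.pair])
  exact ⟨TransClass.trans h1 (by simp), TransClass.trans h1 (by simp)⟩

/-- The first coordinate of an ordered pair. -/
noncomputable def fst (p : ZFSet.{u}) : ZFSet.{u} :=
  ZFSet.sUnion <| (ZFSet.sUnion p).sep fun a => ∃ b ∈ ZFSet.sUnion p, p = ZFSet.pair a b

/-- The second coordinate of an ordered pair. -/
noncomputable def snd (p : ZFSet.{u}) : ZFSet.{u} :=
  ZFSet.sUnion <| (ZFSet.sUnion p).sep fun b => ∃ a ∈ ZFSet.sUnion p, p = ZFSet.pair a b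

/-- The slice `{z | ⟨i, z⟩ ∈ c}` of a set of ordered pairs. -/
noncomputable def slice (c i : ZFSet.{u}) : ZFSet.{u} :=
  (ZFSet.sUnion (ZFSet.sUnion c)).sep fun z => ZFSet.pair i z ∈ c

/-- The value `f(x)` of a function `f`. -/
noncomputable def app (f x : ZFSet.{u}) : ZFSet.{u} :=
  ZFSet.sUnion (slice f x)

theorem sUnion_pair_eq (a b : ZFSet.{u}) : ZFSet.sUnion (ZFSet.pair a b) = {a, b} := by
  ext
  simp [ZFSet.pair]

theorem right_mem_sUnion_sUnion {a b c : ZFSet.{u}} (h : ZFSet.pair a b ∈ c) :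
    b ∈ ZFSet.sUnion (ZFSet.sUnion c) :=
  ZFSet.mem_sUnion_of_mem (z := {a, b}) (by simp)
    (ZFSet.mem_sUnion_of_mem (z := ZFSet.pair a b) (by simp [ZFSet.pair]) h)

@[simp]
theorem mem_slice {c i z : ZFSet.{u}} : z ∈ slice c i ↔ ZFSet.pair i z ∈ c := by
  rw [slice, ZFSet.mem_sep]
  exact ⟨fun h => h.2, fun h => ⟨right_mem_sUnion_sUnion h, h⟩⟩

theorem app_eq_of_forall {f x y : ZFSet.{u}} (h : ZFSet.pair x y ∈ f)
    (hu : ∀ z, ZFSet.pair x z ∈ f → z = y) : app f x = y := by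
  have : slice f x = {y} := by
    ext z
    rw [mem_slice, ZFSet.mem_singleton]
    exact ⟨hu z, fun e => e ▸ h⟩
  rw [app, this, ZFSet.sUnion_singleton]

theorem app_eq_of_isFunc {x y f a b : ZFSet.{u}} (hf : ZFSet.IsFunc x y f)
    (h : ZFSet.pair a b ∈ f) : app f a = b :=
  app_eq_of_forall h fun _ hz => (hf.2 a (ZFSet.pair_mem_prod.1 (hf.1 h)).1).unique hz h

theorem pair_app_mem {x y f a : ZFSet.{u}} (hf : ZFSet.IsFunc x y f) (ha : a ∈ x) :
    ZFSet.pair a (app f a) ∈ f := by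
  obtain ⟨b, hb, -⟩ := hf.2 a ha
  rwa [app_eq_of_isFunc hf hb]

@[simp]
theorem fst_pair (a b : ZFSet.{u}) : fst (ZFSet.pair a b) = a := by
  have : ((ZFSet.sUnion (ZFSet.pair a b)).sep fun c =>
      ∃ d ∈ ZFSet.sUnion (ZFSet.pair a b), ZFSet.pair a b = ZFSet.pair c d) = {a} := by
    ext z
    simp only [sUnion_pair_eq, ZFSet.mem_sep, ZFSet.pair_inj, ZFSet.mem_singleton, ZFSet.mem_pair]
    exact ⟨fun ⟨_, _, _, h, _⟩ => h.symm, fun h => ⟨Or.inl h, b, Or.inr rfl, h.symm, rfl⟩⟩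
  rw [fst, this, ZFSet.sUnion_singleton]

@[simp]
theorem snd_pair (a b : ZFSet.{u}) : snd (ZFSet.pair a b) = b := by
  have : ((ZFSet.sUnion (ZFSet.pair a b)).sep fun d =>
      ∃ c ∈ ZFSet.sUnion (ZFSet.pair a b), ZFSet.pair a b = ZFSet.pair c d) = {b} := by
    ext z
    simp only [sUnion_pair_eq, ZFSet.mem_sep, ZFSet.pair_inj, ZFSet.mem_singleton, ZFSet.mem_pair]
    exact ⟨fun ⟨_, _, _, _, h⟩ => h.symm, fun h => ⟨Or.inr h, a, Or.inl rfl, rfl, h.symm⟩⟩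
  rw [snd, this, ZFSet.sUnion_singleton]

instance DefFun.fst [hs : DefFun M s] : DefFun M fun v => fst (s v) :=
  DefFun.comp₁ (f := RelConstr.fst) (by unfold RelConstr.fst; infer_instance) hs

instance DefFun.snd [hs : DefFun M s] : DefFun M fun v => snd (s v) :=
  DefFun.comp₁ (f := RelConstr.snd) (by unfold RelConstr.snd; infer_instance) hs

instance DefFun.slice [hs : DefFun M s] [ht : DefFun M t] : DefFun M fun v => slice (s v) (t v) :=
  DefFun.comp₂ (f := RelConstr.slice) (by unfold RelConstr.slice; infer_instance) hs ht

instance DefFun.app [hs : DefFun M s] [ht : DefFun M t] : DefFun M fun v => app (s v) (t v) := by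
  unfold RelConstr.app
  infer_instance

instance DefRel.isFunc [hs : DefFun M s] [ht : DefFun M t] [hr : DefFun M r] :
    DefRel M fun v => ZFSet.IsFunc (s v) (t v) (r v) := by
  refine DefRel.comp₃ (R := ZFSet.IsFunc) ?_ hs ht hr
  have : DefRel M fun v : Fin 3 → ZFSet.{u} => v 2 ⊆ ZFSet.prod (v 0) (v 1) ∧
    ∀ z ∈ v 0, ∃ w ∈ M, ZFSet.pair z w ∈ v 2 ∧ ∀ w' ∈ M, ZFSet.pair z w' ∈ v 2 → w' = w :=
      inferInstance
  refine this.congr fun v hv => and_congr_right fun _ => forall₂_congr fun z _ => ?_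
  have hM : ∀ w, ZFSet.pair z w ∈ v 2 → w ∈ M := fun w hw =>
    (mem_class_of_pair (TransClass.trans (hv 2) hw)).2
  exact ⟨fun ⟨w, _, hw, h⟩ => ⟨w, hw, fun w' hw' => h w' (hM w' hw') hw'⟩,
    fun ⟨w, hw, h⟩ => ⟨w, hM w hw, hw, fun w' _ hw' => h w' hw'⟩⟩

/-- The graph of `f` on `X`, as a set of ordered pairs. -/
noncomputable def graphOn (f : ZFSet.{u} → ZFSet.{u}) (X : ZFSet.{u}) : ZFSet.{u} :=
  imageOf (fun y => ZFSet.pair y (f y)) X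

theorem mem_graphOn {f : ZFSet.{u} → ZFSet.{u}} {X p : ZFSet.{u}} :
    p ∈ graphOn f X ↔ ∃ y ∈ X, p = ZFSet.pair y (f y) :=
  mem_imageOf

@[simp]
theorem pair_mem_graphOn {f : ZFSet.{u} → ZFSet.{u}} {X a b : ZFSet.{u}} :
    ZFSet.pair a b ∈ graphOn f X ↔ a ∈ X ∧ b = f a := by
  simp only [mem_graphOn, ZFSet.pair_inj]
  exact ⟨fun ⟨y, hy, h1, h2⟩ => by subst h1; exact ⟨hy, h2⟩, fun h => ⟨a, h.1, rfl, h.2⟩⟩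

theorem graphOn_congr {f g : ZFSet.{u} → ZFSet.{u}} {X : ZFSet.{u}} (h : ∀ x ∈ X, f x = g x) :
    graphOn f X = graphOn g X := by
  ext p
  simp only [mem_graphOn]
  exact exists_congr fun y => and_congr_right fun hy => by rw [h y hy]

theorem app_graphOn {f : ZFSet.{u} → ZFSet.{u}} {X x : ZFSet.{u}} (hx : x ∈ X) :
    app (graphOn f X) x = f x :=
  app_eq_of_forall (by simp [hx]) (by simp)

theorem isFunc_graphOn {f : ZFSet.{u} → ZFSet.{u}} {X Y : ZFSet.{u}} :
    ZFSet.IsFunc X Y (graphOn f X) ↔ ∀ x ∈ X, f x ∈ Y := by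
  constructor
  · intro h x hx
    exact (ZFSet.pair_mem_prod.1 (h.1 (pair_mem_graphOn.2 ⟨hx, rfl⟩))).2
  · intro h
    refine ⟨fun p hp => ?_, fun z hz => ⟨f z, by simp [hz], by simp⟩⟩
    obtain ⟨y, hy, rfl⟩ := mem_graphOn.1 hp
    exact ZFSet.pair_mem_prod.2 ⟨hy, h y hy⟩

theorem restrict_graphOn {f : ZFSet.{u} → ZFSet.{u}} {X Y : ZFSet.{u}} (h : Y ⊆ X) :
    restrict (graphOn f X) Y = graphOn f Y := by
  ext p
  rw [restrict, ZFSet.mem_sep]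
  constructor
  · rintro ⟨hp, x, hx, y, rfl⟩
    exact pair_mem_graphOn.2 ⟨hx, (pair_mem_graphOn.1 hp).2⟩
  · intro hp
    obtain ⟨y, hy, rfl⟩ := mem_graphOn.1 hp
    exact ⟨pair_mem_graphOn.2 ⟨h hy, rfl⟩, y, hy, f y, rfl⟩

instance DefFun.graphOn [ht : DefFun M t] {f : (Fin n → ZFSet.{u}) → ZFSet.{u} → ZFSet.{u}}
    [hf : DefFun M fun w : Fin (n + 1) → ZFSet.{u} => f (fun i => w i.castSucc) (w (Fin.last n))] :
    DefFun M fun v => graphOn (fun x => f v x) (t v) :=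
  DefFun.imageOf (f := fun v x => ZFSet.pair x (f v x))

instance DefFun.restrict [hs : DefFun M s] [ht : DefFun M t] :
    DefFun M fun v => restrict (s v) (t v) := by
  refine DefFun.comp₂ (f := RelConstr.restrict) (DefFun.of_mem (fun v hv z hz => ?_) ?_) hs ht
  · exact TransClass.trans (hv 0) (ZFSet.mem_sep.1 hz).1
  · have : DefRel M fun w : Fin 3 → ZFSet.{u} => w 2 ∈ w 0 ∧
      ∃ x ∈ w 1, ∃ y ∈ M, w 2 = ZFSet.pair x y := inferInstance
    refine this.congr fun w hw => ?_
    refine Iff.trans ?_ ZFSet.mem_sep.symm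
    refine and_congr_right fun _ => exists_congr fun x => and_congr_right fun _ => ?_
    refine exists_congr fun y => and_iff_right_of_imp fun h => ?_
    have := hw 2
    rw [h] at this
    exact (mem_class_of_pair this).2

theorem graphOn_mem_class {f : ZFSet.{u} → ZFSet.{u}}
    (hf : DefFun M fun v : Fin 1 → ZFSet.{u} => f (v 0)) {X : ZFSet.{u}} (hX : X ∈ M) :
    graphOn f X ∈ M := by
  have h : DefFun M fun v : Fin 1 → ZFSet.{u} => graphOn (fun x => f x) (v 0) :=
    DefFun.graphOn (hf := hf.comp₁ (DefFun.var _))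
  exact h.maps (fun _ => X) fun _ => hX

/-- Every ordinal belongs to `M`. -/
theorem toZFSet_mem_class (α : Ordinal.{u}) : α.toZFSet ∈ M := by
  induction α using WellFoundedLT.induction with
  | ind α ih =>
    obtain ⟨Y, hY, hαY⟩ := InnerClass.cover (M := M) α.toZFSet (by
      intro x hx
      obtain ⟨β, hβ, rfl⟩ := Ordinal.mem_toZFSet_iff.1 hx
      exact ih β hβ)
    have hT : Y.sep ZFSet.IsOrdinal ∈ M := InnerClass.sep inferInstance hY
    by_contra hα
    -- the ordinals in the cover are below `α`, as otherwise `α ∈ M` by transitivity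
    have e : Y.sep ZFSet.IsOrdinal = α.toZFSet := by
      ext z
      rw [ZFSet.mem_sep]
      constructor
      · rintro ⟨hzY, hz⟩
        by_contra h
        have hs := (ZFSet.IsOrdinal.notMem_iff_subset hz (ZFSet.isOrdinal_toZFSet α)).1 h
        rcases ((ZFSet.isOrdinal_toZFSet α).subset_iff_eq_or_mem hz).1 hs with h | h
        · exact hα (h ▸ TransClass.trans hY hzY)
        · exact hα (TransClass.trans (TransClass.trans hY hzY) h)
      · intro hz
        exact ⟨hαY hz, (ZFSet.isOrdinal_toZFSet α).mem hz⟩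
    exact hα (e ▸ hT)

instance (α : Ordinal.{u}) : InClass M α.toZFSet := ⟨toZFSet_mem_class α⟩

/-- The least ordinal with the property `P`, and `∅` if there is none. -/
noncomputable def leastOrd (P : ZFSet.{u} → Prop) : ZFSet.{u} :=
  (sInf {α : Ordinal.{u} | P α.toZFSet}).toZFSet

theorem leastOrd_spec {P : ZFSet.{u} → Prop} {α : Ordinal.{u}} (h : P α.toZFSet) :
    P (leastOrd P) :=
  csInf_mem (s := {α : Ordinal.{u} | P α.toZFSet}) ⟨α, h⟩

theorem mem_leastOrd {P : ZFSet.{u} → Prop} {z : ZFSet.{u}} : z ∈ leastOrd P ↔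
    (∃ α : Ordinal.{u}, P α.toZFSet) ∧ ∀ α : Ordinal.{u}, P α.toZFSet → z ∈ α.toZFSet := by
  constructor
  · intro h
    refine ⟨?_, fun α hα => Ordinal.toZFSet_subset_toZFSet_iff.2 (csInf_le' hα) h⟩
    by_contra! hne
    have e : {α : Ordinal.{u} | P α.toZFSet} = ∅ := by
      ext α
      simpa using hne α
    simp [leastOrd, e] at h
  · rintro ⟨⟨α, hα⟩, h⟩
    exact h _ (leastOrd_spec hα)

instance DefFun.leastOrd {P : (Fin n → ZFSet.{u}) → ZFSet.{u} → Prop}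
    [hP : DefRel M fun w : Fin (n + 1) → ZFSet.{u} => P (fun i => w i.castSucc) (w (Fin.last n))] :
    DefFun M fun v => leastOrd fun x => P v x := by
  refine DefFun.of_mem (fun v hv z hz => ?_) ?_
  · exact TransClass.trans (toZFSet_mem_class _) hz
  · have h2 := hP.rename (n := n + 2)
      (Fin.lastCases (Fin.last (n + 1)) fun i => i.castSucc.castSucc)
    have h2 : DefRel M fun w : Fin (n + 2) → ZFSet.{u} =>
        P (fun i => w i.castSucc.castSucc) (w (Fin.last (n + 1))) := by simpa using h2
    have h3 : DefRel M fun w : Fin (n + 1) → ZFSet.{u} =>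
        ∃ x ∈ M, x.IsOrdinal ∧ P (fun i => w i.castSucc) x :=
      DefRel.existsMem (Q := fun w x => x.IsOrdinal ∧ P (fun i => w i.castSucc) x)
    have h4 : DefRel M fun w : Fin (n + 1) → ZFSet.{u} =>
        ∀ x ∈ M, x.IsOrdinal → P (fun i => w i.castSucc) x → w (Fin.last n) ∈ x :=
      DefRel.forallMem
        (Q := fun w x => x.IsOrdinal → P (fun i => w i.castSucc) x → w (Fin.last n) ∈ x)
    refine (DefRel.and (hP := h3) (hQ := h4)).congr fun w _ => ?_
    rw [mem_leastOrd]
    refine and_congr ⟨?_, ?_⟩ ⟨?_, ?_⟩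
    · rintro ⟨x, -, hx, h⟩
      exact ⟨x.rank, by rwa [hx.toZFSet_rank_eq]⟩
    · rintro ⟨α, h⟩
      exact ⟨_, toZFSet_mem_class α, ZFSet.isOrdinal_toZFSet α, h⟩
    · intro h α hα
      exact h _ (toZFSet_mem_class α) (ZFSet.isOrdinal_toZFSet α) hα
    · intro h x _ hx hP
      have := h x.rank
      rw [hx.toZFSet_rank_eq] at this
      exact this hP

end Inner

end RelConstr

/-! ### Recursion along membership -/

namespace RelConstr

/-- The function `F(p, ·)` given by `F(p, x) = G(p, x, F(p, ·) ↾ x)`. -/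
noncomputable def memRec (G : ZFSet.{u} → ZFSet.{u} → ZFSet.{u} → ZFSet.{u}) (p x : ZFSet.{u}) :
    ZFSet.{u} :=
  ZFSet.mem_wf.fix
    (fun x ih => G p x (ZFSet.range fun y : x => ZFSet.pair y (ih y.1 y.2))) x

variable {G : ZFSet.{u} → ZFSet.{u} → ZFSet.{u} → ZFSet.{u}}

theorem memRec_eq (p x : ZFSet.{u}) : memRec G p x = G p x (graphOn (memRec G p) x) := by
  unfold memRec
  rw [WellFounded.fix_eq]
  rfl

/-- `s` is a set of ordered pairs with transitive domain that obeys the recursion given by `G`. -/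
def IsApprox (G : ZFSet.{u} → ZFSet.{u} → ZFSet.{u} → ZFSet.{u}) (p s : ZFSet.{u}) : Prop :=
  ∀ q ∈ s, q = ZFSet.pair (fst q) (snd q) ∧ snd q = G p (fst q) (restrict s (fst q)) ∧
    ∀ y ∈ fst q, ZFSet.pair y (app s y) ∈ s

theorem IsApprox.eq_memRec {p s : ZFSet.{u}} (h : IsApprox G p s) {x : ZFSet.{u}} :
    ∀ y, ZFSet.pair x y ∈ s → y = memRec G p x := by
  induction x using ZFSet.inductionOn with
  | h x ih =>
    intro y hy
    obtain ⟨-, h2, h3⟩ := h _ hy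
    simp only [fst_pair, snd_pair] at h2 h3
    rw [memRec_eq, h2]
    congr 1
    ext q
    rw [restrict, ZFSet.mem_sep, mem_graphOn]
    constructor
    · rintro ⟨hq, z, hz, w, rfl⟩
      exact ⟨z, hz, by rw [ih z hz w hq]⟩
    · rintro ⟨z, hz, rfl⟩
      have := h3 z hz
      rw [ih z hz _ this] at this
      exact ⟨this, z, hz, _, rfl⟩

theorem isApprox_iff {p s : ZFSet.{u}} : IsApprox G p s ↔
    ∀ q ∈ s, ∃ x, q = ZFSet.pair x (memRec G p x) ∧
      ∀ y ∈ x, ZFSet.pair y (memRec G p y) ∈ s := by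
  constructor
  · intro h q hq
    obtain ⟨h1, -, h3⟩ := h q hq
    rw [h1] at hq
    have e := h.eq_memRec _ hq
    refine ⟨fst q, by rw [← e]; exact h1, fun y hy => ?_⟩
    have := h3 y hy
    rwa [h.eq_memRec _ this] at this
  · intro h q hq
    obtain ⟨x, rfl, h3⟩ := h q hq
    have huniq : ∀ y z, ZFSet.pair y z ∈ s → z = memRec G p y := by
      intro y z hyz
      obtain ⟨x, hx, -⟩ := h _ hyz
      rw [ZFSet.pair_inj] at hx
      rw [hx.2, hx.1]
    simp only [fst_pair, snd_pair, true_and]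
    refine ⟨?_, fun y hy => ?_⟩
    · rw [memRec_eq]
      congr 1
      ext q
      rw [restrict, ZFSet.mem_sep, mem_graphOn]
      constructor
      · rintro ⟨y, hy, rfl⟩
        exact ⟨h3 y hy, y, hy, _, rfl⟩
      · rintro ⟨hq, y, hy, z, rfl⟩
        exact ⟨y, hy, by rw [huniq _ _ hq]⟩
    · rw [app_eq_of_forall (h3 y hy) fun z => huniq y z]
      exact h3 y hy

variable {M : Set ZFSet.{u}} [InnerClass M] {n : ℕ}

instance DefRel.isApprox [hG : DefFun M fun v : Fin 3 → ZFSet.{u} => G (v 0) (v 1) (v 2)]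
    {s t : (Fin n → ZFSet.{u}) → ZFSet.{u}} [hs : DefFun M s] [ht : DefFun M t] :
    DefRel M fun v => IsApprox G (s v) (t v) := by
  refine DefRel.comp₂ (R := IsApprox G) ?_ hs ht
  unfold IsApprox
  have : DefFun M fun w : Fin 3 → ZFSet.{u} => G (w 0) (fst (w 2)) (restrict (w 1) (fst (w 2))) :=
    hG.comp₃ inferInstance inferInstance inferInstance
  have : DefRel M fun w : Fin 3 → ZFSet.{u} =>
      snd (w 2) = G (w 0) (fst (w 2)) (restrict (w 1) (fst (w 2))) := inferInstance
  refine DefRel.forallIn (Q := fun v q => q = ZFSet.pair (fst q) (snd q) ∧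
    snd q = G (v 0) (fst q) (restrict (v 1) (fst q)) ∧
      ∀ y ∈ fst q, ZFSet.pair y (app (v 1) y) ∈ v 1)
    (hQ := DefRel.and (hQ := DefRel.and (hP := this)))

/-- The values of a function defined by recursion, and approximations with them, exist in `M`. -/
theorem exists_isApprox [hG : DefFun M fun v : Fin 3 → ZFSet.{u} => G (v 0) (v 1) (v 2)]
    {p : ZFSet.{u}} (hp : p ∈ M) {x : ZFSet.{u}} (hx : x ∈ M) :
    ∃ s ∈ M, IsApprox G p s ∧ ZFSet.pair x (memRec G p x) ∈ s := by
  induction x using ZFSet.inductionOn with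
  | h x ih =>
    choose! f hfM hfA hfx using fun y hy => ih y hy (TransClass.trans hx hy)
    obtain ⟨Y, hY, hxY⟩ := InnerClass.cover (M := M) (imageOf f x) (by
      intro z hz
      obtain ⟨y, hy, rfl⟩ := mem_imageOf.1 hz
      exact hfM y hy)
    have : InClass M p := ⟨hp⟩
    have hsep : DefFun M fun v : Fin 1 → ZFSet.{u} =>
        ZFSet.sUnion ((v 0).sep fun s => IsApprox G p s) := inferInstance
    -- the union of all approximations in the cover is an approximation
    set S := ZFSet.sUnion (Y.sep fun s => IsApprox G p s) with hS
    have hSM : S ∈ M := hsep.maps (fun _ => Y) fun _ => hY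
    have hSA : ∀ q ∈ S, ∃ x, q = ZFSet.pair x (memRec G p x) ∧
        ∀ y ∈ x, ZFSet.pair y (memRec G p y) ∈ S := by
      intro q hq
      obtain ⟨s, hs, hqs⟩ := ZFSet.mem_sUnion.1 hq
      obtain ⟨z, hz, h⟩ := isApprox_iff.1 (ZFSet.mem_sep.1 hs).2 q hqs
      exact ⟨z, hz, fun y hy => ZFSet.mem_sUnion_of_mem (h y hy) hs⟩
    have hSx : ∀ y ∈ x, ZFSet.pair y (memRec G p y) ∈ S := fun y hy =>
      ZFSet.mem_sUnion_of_mem (hfx y hy)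
        (ZFSet.mem_sep.2 ⟨hxY (mem_imageOf.2 ⟨y, hy, rfl⟩), hfA y hy⟩)
    have hSR : restrict S x = graphOn (memRec G p) x := by
      ext q
      rw [restrict, ZFSet.mem_sep, mem_graphOn]
      constructor
      · rintro ⟨hq, y, hy, z, rfl⟩
        obtain ⟨y', h, -⟩ := hSA _ hq
        rw [ZFSet.pair_inj] at h
        exact ⟨y, hy, by rw [h.2, h.1]⟩
      · rintro ⟨y, hy, rfl⟩
        exact ⟨hSx y hy, y, hy, _, rfl⟩
    have hval : memRec G p x ∈ M := by
      rw [memRec_eq, ← hSR]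
      have : DefFun M fun v : Fin 3 → ZFSet.{u} => G (v 0) (v 1) (restrict (v 2) (v 1)) :=
        hG.comp₃ inferInstance inferInstance inferInstance
      exact this.maps ![p, x, S] (by simpa [Fin.forall_fin_succ] using ⟨hp, hx, hSM⟩)
    refine ⟨insert (ZFSet.pair x (memRec G p x)) S, ?_, ?_, by simp⟩
    · have : DefFun M fun v : Fin 2 → ZFSet.{u} => (insert (v 0) (v 1) : ZFSet.{u}) :=
        inferInstance
      exact this.maps ![ZFSet.pair x (memRec G p x), S] (by
        simpa [Fin.forall_fin_succ] using ⟨pair_mem_class hx hval, hSM⟩)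
    · rw [isApprox_iff]
      intro q hq
      rcases ZFSet.mem_insert_iff.1 hq with rfl | hq
      · exact ⟨x, rfl, fun y hy => ZFSet.mem_insert_of_mem _ (hSx y hy)⟩
      · obtain ⟨z, hz, h⟩ := hSA q hq
        exact ⟨z, hz, fun y hy => ZFSet.mem_insert_of_mem _ (h y hy)⟩

/-- A function defined from a definable function by recursion along `∈` is definable. -/
instance DefFun.memRec [hG : DefFun M fun v : Fin 3 → ZFSet.{u} => G (v 0) (v 1) (v 2)]
    {s t : (Fin n → ZFSet.{u}) → ZFSet.{u}} [hs : DefFun M s] [ht : DefFun M t] :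
    DefFun M fun v => memRec G (s v) (t v) := by
  refine DefFun.comp₂ (f := RelConstr.memRec G) ⟨fun v hv => ?_, ?_⟩ hs ht
  · obtain ⟨S, hS, -, h⟩ := exists_isApprox (G := G) (hv 0) (hv 1)
    exact (mem_class_of_pair (TransClass.trans hS h)).2
  · have : DefRel M fun w : Fin 3 → ZFSet.{u} =>
        ∃ S ∈ M, IsApprox G (w 0) S ∧ ZFSet.pair (w 1) (w 2) ∈ S := inferInstance
    refine this.congr fun w hw => ?_
    constructor
    · rintro ⟨S, -, hS, h⟩
      exact hS.eq_memRec _ h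
    · intro h
      obtain ⟨S, hS, hA, hx⟩ := exists_isApprox (G := G) (hw 0) (hw 1)
      exact ⟨S, hS, hA, by rw [show w 2 = _ from h]; exact hx⟩

end RelConstr

/-! ### The constructible hierarchy over a set is an inner model -/

namespace RelConstr

theorem mem_defPow {X y : ZFSet.{u}} : y ∈ defPow X ↔
    y ⊆ X ∧ DefRel (X : Set ZFSet.{u}) fun v : Fin 1 → ZFSet.{u} => v 0 ∈ y := by
  rw [defPow, ZFSet.mem_sep, ZFSet.mem_powerset]
  refine and_congr_right fun _ => ?_
  rw [Set.Definable₁, Set.definable_iff_exists_formula_sum]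
  constructor
  · rintro ⟨φ, hφ⟩
    refine ⟨(BoundedFormula.relabel (k := 0)
      (Sum.elim (fun x => Sum.inl x.1) fun i => Sum.inr i) φ :
      langSet.BoundedFormula {z // z ∈ X} (1 + 0)), fun v => ?_⟩
    have h := Set.ext_iff.1 hφ v
    refine Iff.trans ?_ h.symm
    refine (BoundedFormula.realize_relabel (M := {z // z ∈ X})).trans ?_
    refine iff_of_eq ?_
    change BoundedFormula.Realize φ _ _ = BoundedFormula.Realize φ _ _
    congr 1
    · ext (i | i) <;> simp
    · ext i
      exact i.elim0
  · rintro ⟨φ, hφ⟩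
    refine ⟨φ.toFormula.relabel (Sum.map (fun x => ⟨x, trivial⟩) id), ?_⟩
    ext v
    refine (hφ v).symm.trans ?_
    refine Iff.trans ?_ (Formula.realize_relabel (M := {z // z ∈ X})).symm
    refine Iff.trans ?_ (BoundedFormula.realize_toFormula (M := {z // z ∈ X}) φ _).symm
    rfl

theorem mem_defPow_self (X : ZFSet.{u}) : X ∈ defPow X := by
  refine mem_defPow.2 ⟨fun _ h => h, ?_⟩
  have : DefRel (X : Set ZFSet.{u}) fun _ : Fin 1 → ZFSet.{u} => True := inferInstance
  exact this.congr fun v hv => by simpa using hv 0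

theorem subset_defPow {X : ZFSet.{u}} (hX : X.IsTransitive) : X ⊆ defPow X := by
  intro x hx
  refine mem_defPow.2 ⟨hX x hx, ?_⟩
  have : InClass (X : Set ZFSet.{u}) x := ⟨hx⟩
  infer_instance

theorem isTransitive_defPow {X : ZFSet.{u}} (hX : X.IsTransitive) : (defPow X).IsTransitive :=
  fun _ hy _ hz => subset_defPow hX ((mem_defPow.1 hy).1 hz)

variable (A : ZFSet.{u})

theorem lStage_isTransitive_and_mono (α : Ordinal.{u}) :
    (lStage A α).IsTransitive ∧ ∀ β ≤ α, lStage A β ⊆ lStage A α := by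
  induction α using Ordinal.limitRecOn with
  | zero =>
    rw [lStage_zero]
    refine ⟨isTransitive_trcl A, fun β hβ => ?_⟩
    rw [nonpos_iff_eq_zero.1 hβ, lStage_zero]
  | add_one α ih =>
    rw [lStage_add_one]
    refine ⟨isTransitive_defPow ih.1, fun β hβ => ?_⟩
    rcases hβ.eq_or_lt with rfl | h
    · rw [lStage_add_one]
    · exact fun x hx => subset_defPow ih.1 (ih.2 β (Order.lt_add_one_iff.1 h) hx)
  | limit α hα ih =>
    rw [lStage_limit A hα]
    refine ⟨ZFSet.IsTransitive.iUnion fun β => (ih β.1 β.2).1, fun β hβ => ?_⟩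
    rcases hβ.eq_or_lt with rfl | h
    · rw [lStage_limit A hα]
    · exact ZFSet.subset_iUnion (fun β : Set.Iio α => lStage A β.1) ⟨β, h⟩

theorem isTransitive_lStage (α : Ordinal.{u}) : (lStage A α).IsTransitive :=
  (lStage_isTransitive_and_mono A α).1

theorem lStage_mono {α β : Ordinal.{u}} (h : β ≤ α) : lStage A β ⊆ lStage A α :=
  (lStage_isTransitive_and_mono A α).2 β h

theorem lStage_mem (α : Ordinal.{u}) : lStage A α ∈ lStage A (α + 1) := by
  rw [lStage_add_one]
  exact mem_defPow_self _

/-- The stages are determined by taking definable power sets along the ordinals, without a case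
distinction. -/
theorem mem_lStage {α : Ordinal.{u}} {x : ZFSet.{u}} :
    x ∈ lStage A α ↔ x ∈ trcl A ∨ ∃ β < α, x ∈ defPow (lStage A β) := by
  constructor
  · intro h
    induction α using Ordinal.limitRecOn with
    | zero => exact Or.inl (by rwa [lStage_zero] at h)
    | add_one α ih => exact Or.inr ⟨α, Order.lt_add_one_iff.2 le_rfl, by rwa [lStage_add_one] at h⟩
    | limit α hα ih =>
      rw [lStage_limit A hα, ZFSet.mem_iUnion] at h
      obtain ⟨β, h⟩ := h
      exact (ih β.1 β.2 h).imp id fun ⟨γ, hγ, h⟩ => ⟨γ, hγ.trans β.2, h⟩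
  · rintro (h | ⟨β, hβ, h⟩)
    · exact lStage_mono A zero_le (by rwa [lStage_zero])
    · rw [← lStage_add_one] at h
      exact lStage_mono A (Order.add_one_le_of_lt hβ) h

theorem lStage_subset_lClass {α : Ordinal.{u}} {x : ZFSet.{u}} (h : x ∈ lStage A α) :
    x ∈ lClass A :=
  ⟨α, h⟩

/-- A set of elements of `L(A)` is contained in some stage. -/
theorem exists_subset_lStage {ι : Type*} [Small.{u} ι] (f : ι → ZFSet.{u})
    (hf : ∀ i, f i ∈ lClass A) : ∃ α, ∀ i, f i ∈ lStage A α := by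
  choose g hg using hf
  exact ⟨⨆ i, g i, fun i => lStage_mono A (Ordinal.le_iSup g i) (hg i)⟩

instance : TransClass (lClass A) :=
  ⟨fun ⟨α, h⟩ hy => ⟨α, (isTransitive_lStage A α).mem_trans hy h⟩⟩

/-- The inclusion of a stage in `L(A)`. -/
def stageEmbedding (α : Ordinal.{u}) :
    (lStage A α : Set ZFSet.{u}) ↪[langSet] lClass A where
  toFun x := ⟨x.1, α, x.2⟩
  inj' x y h := Subtype.ext (congrArg (fun z => z.1) h)
  map_fun' := fun f _ => f.elim
  map_rel' := by
    intro n (r : MemRel n) x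
    cases r
    exact Iff.rfl

/-- Witnesses for formulas with parameters in a stage are found in a later stage. -/
theorem exists_witness_stage (α : Ordinal.{u}) : ∃ β > α, ∀ (n : ℕ)
    (φ : langSet.BoundedFormula Empty (n + 1)) (x : Fin n → lClass A) (a : lClass A),
    (∀ i, (x i).1 ∈ lStage A α) → φ.Realize default (Fin.snoc x a : Fin (n + 1) → lClass A) →
    ∃ b : lClass A, b.1 ∈ lStage A β ∧
      φ.Realize default (Fin.snoc x b : Fin (n + 1) → lClass A) := by
  classical
  let ι := Σ n : ℕ, langSet.BoundedFormula Empty (n + 1) × (Fin n → lStage A α)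
  let emb {n : ℕ} (x : Fin n → lStage A α) : Fin n → lClass A := fun i => ⟨(x i).1, α, (x i).2⟩
  let P (i : ι) (b : lClass A) : Prop :=
    i.2.1.Realize default (Fin.snoc (emb i.2.2) b : Fin (i.1 + 1) → lClass A)
  have hne : Nonempty (lClass A) := ⟨⟨_, lStage_subset_lClass A (lStage_mem A 0)⟩⟩
  let f (i : ι) : lClass A := Classical.epsilon (P i)
  obtain ⟨β, hβ⟩ := exists_subset_lStage A (fun i => (f i).1) fun i => (f i).2
  refine ⟨max β (α + 1), lt_max_of_lt_right (Order.lt_add_one_iff.2 le_rfl), ?_⟩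
  intro n φ x a hx h
  let i : ι := ⟨n, φ, fun j => ⟨(x j).1, hx j⟩⟩
  exact ⟨f i, lStage_mono A (le_max_left _ _) (hβ i), Classical.epsilon_spec (p := P i) ⟨a, h⟩⟩

/-- Reflection: arbitrarily high stages are elementary submodels of `L(A)`. -/
theorem exists_elementary_stage (α : Ordinal.{u}) : ∃ β ≥ α,
    ∃ f : (lStage A β : Set ZFSet.{u}) ↪ₑ[langSet] lClass A, ∀ x, (f x).1 = x.1 := by
  choose g hg hgw using exists_witness_stage A
  let a : ℕ → Ordinal.{u} := fun k => g^[k] α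
  have ha : ∀ k, a (k + 1) = g (a k) := fun k => Function.iterate_succ_apply' g k α
  have hlt : ∀ k, a k < a (k + 1) := fun k => by
    rw [ha]
    exact hg _
  have hmono : Monotone a := monotone_nat_of_le_succ fun k => (hlt k).le
  have hle : ∀ k, a k ≤ ⨆ k, a k := fun k => Ordinal.le_iSup a k
  have hlim : Order.IsSuccLimit (⨆ k, a k) := by
    refine ⟨fun h => ?_, ?_⟩
    · exact absurd ((hlt 0).trans_le (hle 1)) (by rw [isMin_iff_eq_bot.1 h]; exact not_lt_bot)
    · rw [Order.isSuccPrelimit_iff_succ_lt]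
      intro γ hγ
      obtain ⟨k, hk⟩ := Ordinal.lt_iSup_iff.1 hγ
      exact (Order.succ_le_of_lt hk).trans_lt ((hlt k).trans_le (hle _))
  refine ⟨⨆ k, a k, hle 0, (stageEmbedding A _).toElementaryEmbedding ?_, fun x => rfl⟩
  intro n φ x b hb
  have hx : ∃ k, ∀ i, (x i).1 ∈ lStage A (a k) := by
    have : ∀ i, ∃ k, (x i).1 ∈ lStage A (a k) := by
      intro i
      have h : ∀ y ∈ lStage A (⨆ k, a k), ∃ γ : Set.Iio (⨆ k, a k), y ∈ lStage A γ.1 := by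
        intro y hy
        rwa [lStage_limit A hlim, ZFSet.mem_iUnion] at hy
      obtain ⟨γ, h⟩ := h _ (x i).2
      obtain ⟨k, hk⟩ := Ordinal.lt_iSup_iff.1 γ.2
      exact ⟨k, lStage_mono A hk.le h⟩
    choose k hk using this
    refine ⟨Finset.univ.sup k, fun i => lStage_mono A (hmono ?_) (hk i)⟩
    exact Finset.le_sup (f := k) (Finset.mem_univ i)
  obtain ⟨k, hk⟩ := hx
  obtain ⟨c, hc, hφ⟩ := hgw (a k) n φ (stageEmbedding A _ ∘ x) b hk hb
  rw [← ha] at hc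
  exact ⟨⟨c.1, lStage_mono A (hle _) hc⟩, hφ⟩

instance : InnerClass (lClass A) where
  sep := by
    classical
    intro P hP X hX
    obtain ⟨φ, hφ⟩ := hP.out
    -- a stage that contains `X` and the parameters of the formula
    obtain ⟨α₁, h₁⟩ := hX
    obtain ⟨α₂, h₂⟩ := exists_subset_lStage A (fun p : φ.freeVarFinset => p.1.1) fun p => p.1.2
    obtain ⟨β, hβ, f, hf⟩ := exists_elementary_stage A (max α₁ α₂)
    have hX : X ∈ lStage A β := lStage_mono A ((le_max_left _ _).trans hβ) h₁
    have hp : ∀ p : φ.freeVarFinset, p.1.1 ∈ lStage A β := fun p =>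
      lStage_mono A ((le_max_right _ _).trans hβ) (h₂ p)
    refine ⟨β + 1, ?_⟩
    rw [lStage_add_one, mem_defPow]
    refine ⟨fun x hx => (isTransitive_lStage A β).mem_trans (ZFSet.mem_sep.1 hx).1 hX, ?_⟩
    let ψ : langSet.BoundedFormula (lStage A β : Set ZFSet.{u}) 1 :=
      φ.restrictFreeVar fun p => ⟨p.1.1, hp p⟩
    have hψ : DefRel (lStage A β : Set ZFSet.{u}) fun v : Fin 1 → ZFSet.{u} => P (v 0) := by
      refine ⟨ψ, fun v => ?_⟩
      have h := hφ (f ∘ v)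
      simp only [Function.comp_apply, hf] at h
      rw [← h, ← f.map_boundedFormula]
      rw [BoundedFormula.realize_restrictFreeVar (v' := id)]
      intro a
      exact Subtype.ext (hf _)
    have : InClass (lStage A β : Set ZFSet.{u}) X := ⟨hX⟩
    have : DefRel (lStage A β : Set ZFSet.{u}) fun v : Fin 1 → ZFSet.{u} => v 0 ∈ X ∧ P (v 0) :=
      inferInstance
    exact this.congr fun v _ => ZFSet.mem_sep.symm
  cover := by
    intro S hS
    obtain ⟨α, hα⟩ := exists_subset_lStage A (fun x : S => x.1) fun x => hS _ x.2
    exact ⟨_, lStage_subset_lClass A (lStage_mem A α), fun x hx => hα ⟨x, hx⟩⟩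

end RelConstr

/-! ### Finite sequences -/

namespace RelConstr

/-- The natural number `n` as a von Neumann ordinal. -/
noncomputable def nat (n : ℕ) : ZFSet.{u} := (n : Ordinal.{u}).toZFSet

/-- The set of natural numbers. -/
noncomputable def natSet : ZFSet.{u} := Ordinal.omega0.toZFSet

theorem mem_natSet {z : ZFSet.{u}} : z ∈ natSet ↔ ∃ n : ℕ, z = nat n := by
  rw [natSet, Ordinal.mem_toZFSet_iff]
  constructor
  · rintro ⟨a, ha, rfl⟩
    obtain ⟨n, rfl⟩ := Ordinal.lt_omega0.1 ha
    exact ⟨n, rfl⟩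
  · rintro ⟨n, rfl⟩
    exact ⟨n, Ordinal.natCast_lt_omega0 n, rfl⟩

theorem nat_mem_natSet (n : ℕ) : nat n ∈ natSet := mem_natSet.2 ⟨n, rfl⟩

@[simp]
theorem nat_inj {m n : ℕ} : nat.{u} m = nat n ↔ m = n := by
  simp [nat, Ordinal.toZFSet_injective.eq_iff]

theorem nat_mem_nat {m n : ℕ} : nat.{u} m ∈ nat n ↔ m < n := by
  simp [nat, Ordinal.toZFSet_mem_toZFSet_iff]

theorem mem_nat {n : ℕ} {z : ZFSet.{u}} : z ∈ nat n ↔ ∃ i : Fin n, z = nat i := by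
  rw [nat, Ordinal.mem_toZFSet_iff]
  constructor
  · rintro ⟨a, ha, rfl⟩
    obtain ⟨m, rfl⟩ := Ordinal.lt_omega0.1 (ha.trans (Ordinal.natCast_lt_omega0 n))
    exact ⟨⟨m, by exact_mod_cast ha⟩, rfl⟩
  · rintro ⟨i, rfl⟩
    exact ⟨i, by exact_mod_cast i.2, rfl⟩

theorem insert_nat (n : ℕ) : insert (nat.{u} n) (nat n) = nat (n + 1) := by
  simp [nat, Ordinal.toZFSet_add_one]

/-- The finite sequence `v` as a set of ordered pairs. -/
noncomputable def enc {n : ℕ} (v : Fin n → ZFSet.{u}) : ZFSet.{u} :=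
  ZFSet.range fun i : Fin n => ZFSet.pair (nat i) (v i)

theorem mem_enc {n : ℕ} {v : Fin n → ZFSet.{u}} {p : ZFSet.{u}} :
    p ∈ enc v ↔ ∃ i : Fin n, p = ZFSet.pair (nat i) (v i) := by
  simp [enc, eq_comm]

theorem pair_mem_enc {n : ℕ} {v : Fin n → ZFSet.{u}} {a b : ZFSet.{u}} :
    ZFSet.pair a b ∈ enc v ↔ ∃ i : Fin n, a = nat i ∧ b = v i := by
  simp [mem_enc]

theorem enc_injective {n : ℕ} : Function.Injective (enc : (Fin n → ZFSet.{u}) → ZFSet.{u}) := by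
  intro v w h
  ext1 i
  have : ZFSet.pair (nat i) (v i) ∈ enc w := h ▸ pair_mem_enc.2 ⟨i, rfl, rfl⟩
  obtain ⟨j, hij, hj⟩ := pair_mem_enc.1 this
  rw [nat_inj] at hij
  rw [hj, Fin.ext hij]

theorem enc_snoc {n : ℕ} (v : Fin n → ZFSet.{u}) (x : ZFSet.{u}) :
    enc (Fin.snoc v x : Fin (n + 1) → ZFSet.{u}) = insert (ZFSet.pair (nat n) x) (enc v) := by
  ext p
  rw [ZFSet.mem_insert_iff, mem_enc, mem_enc, Fin.exists_fin_succ']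
  simp [or_comm]

theorem enc_zero (v : Fin 0 → ZFSet.{u}) : enc v = ∅ := by
  ext p
  simp [mem_enc]

theorem enc_one (v : Fin 1 → ZFSet.{u}) : enc v = {ZFSet.pair (nat 0) (v 0)} := by
  ext p
  simp [mem_enc]

/-- The set of finite sequences of length `n` with entries in `X`; empty unless `n` is a natural
number. -/
noncomputable def seqs (X n : ZFSet.{u}) : ZFSet.{u} :=
  (ZFSet.funs n X).sep fun _ => n ∈ natSet

theorem mem_seqs {X s : ZFSet.{u}} {n : ℕ} :
    s ∈ seqs X (nat n) ↔ ∃ v : Fin n → ZFSet.{u}, (∀ i, v i ∈ X) ∧ s = enc v := by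
  rw [seqs, ZFSet.mem_sep, ZFSet.mem_funs]
  constructor
  · rintro ⟨h, -⟩
    have hi : ∀ i : Fin n, nat i ∈ nat n := fun i => nat_mem_nat.2 i.2
    refine ⟨fun i => app s (nat i), fun i => ?_, ?_⟩
    · exact (ZFSet.pair_mem_prod.1 (h.1 (pair_app_mem h (hi i)))).2
    · ext p
      rw [mem_enc]
      constructor
      · intro hp
        obtain ⟨a, ha, b, -, rfl⟩ := ZFSet.mem_prod.1 (h.1 hp)
        obtain ⟨i, rfl⟩ := mem_nat.1 ha
        exact ⟨i, by rw [app_eq_of_isFunc h hp]⟩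
      · rintro ⟨i, rfl⟩
        exact pair_app_mem h (hi i)
  · rintro ⟨v, hv, rfl⟩
    refine ⟨⟨fun p hp => ?_, fun z hz => ?_⟩, nat_mem_natSet n⟩
    · obtain ⟨i, rfl⟩ := mem_enc.1 hp
      exact ZFSet.pair_mem_prod.2 ⟨nat_mem_nat.2 i.2, hv i⟩
    · obtain ⟨i, rfl⟩ := mem_nat.1 hz
      refine ⟨v i, pair_mem_enc.2 ⟨i, rfl, rfl⟩, fun y hy => ?_⟩
      obtain ⟨j, hij, rfl⟩ := pair_mem_enc.1 hy
      rw [nat_inj] at hij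
      rw [Fin.ext hij]

theorem enc_mem_seqs {X : ZFSet.{u}} {n : ℕ} {v : Fin n → ZFSet.{u}} (hv : ∀ i, v i ∈ X) :
    enc v ∈ seqs X (nat n) :=
  mem_seqs.2 ⟨v, hv, rfl⟩

section

variable {M : Set ZFSet.{u}} [InnerClass M] {n : ℕ} {s t : (Fin n → ZFSet.{u}) → ZFSet.{u}}

instance (n : ℕ) : InClass M (nat n) := ⟨toZFSet_mem_class _⟩

instance : InClass M natSet := ⟨toZFSet_mem_class _⟩

theorem enc_mem_class {n : ℕ} {v : Fin n → ZFSet.{u}} (hv : ∀ i, v i ∈ M) : enc v ∈ M := by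
  induction n with
  | zero =>
    rw [enc_zero]
    exact InClass.mem
  | succ n ih =>
    rw [← Fin.snoc_init_self v, enc_snoc]
    have : DefFun M fun w : Fin 2 → ZFSet.{u} =>
        (insert (ZFSet.pair (nat n) (w 0)) (w 1) : ZFSet) :=
      inferInstance
    exact this.maps ![v (Fin.last n), enc (Fin.init v)] (by
      simpa [Fin.forall_fin_succ] using ⟨hv _, ih fun i => hv _⟩)

instance DefFun.seqs [hs : DefFun M s] [ht : DefFun M t] : DefFun M fun v => seqs (s v) (t v) := by
  refine DefFun.comp₂ (f := RelConstr.seqs) (DefFun.of_mem (fun v hv z hz => ?_) ?_) hs ht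
  · obtain ⟨n, hn⟩ := mem_natSet.1 (ZFSet.mem_sep.1 hz).2
    rw [hn] at hz
    obtain ⟨w, hw, rfl⟩ := mem_seqs.1 hz
    exact enc_mem_class fun i => TransClass.trans (hv 0) (hw i)
  · simp only [RelConstr.seqs, ZFSet.mem_sep, ZFSet.mem_funs]
    infer_instance

end

/-! ### Definable relations as sets of finite sequences -/

/-- The term with code `c` takes the value `u` at the sequence `s`. The code of the variable `i` is
`⟨0, i⟩`, that of the constant `p` is `⟨1, p⟩`. -/
def TermVal (c s u : ZFSet.{u}) : Prop :=
  (c = ZFSet.pair (nat 0) (snd c) ∧ ZFSet.pair (snd c) u ∈ s) ∨ c = ZFSet.pair (nat 1) u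

/-- The tuple `⟨i, X, n, R, S⟩`. -/
noncomputable def tup (i X n R S : ZFSet.{u}) : ZFSet.{u} :=
  ZFSet.pair i (ZFSet.pair X (ZFSet.pair n (ZFSet.pair R S)))

/-- The operations that generate the definable relations over a set `X`, in one function. The
argument is a tuple `⟨i, X, n, R, S⟩`. For `i = 0, 1, 2, 3` the value is the set of the
sequences of length `n` that satisfy, respectively, the formula `R ∈ S` or `R = S` between terms
with codes `R` and `S`, the implication from `R` to `S`, or the universal quantification of `R`
over the last variable. For `i = 4` it is the subset of `X` that corresponds to the set `R` of
sequences of length `1`. -/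
noncomputable def op (y : ZFSet.{u}) : ZFSet.{u} :=
  (fst (snd y) ∪ seqs (fst (snd y)) (fst (snd (snd y)))).sep fun s =>
    (s ∈ seqs (fst (snd y)) (fst (snd (snd y))) ∧
      ((fst y = nat 0 ∧ ∃ a ∈ fst (snd y), ∃ b ∈ fst (snd y),
          TermVal (fst (snd (snd (snd y)))) s a ∧ TermVal (snd (snd (snd (snd y)))) s b ∧ a ∈ b) ∨
        (fst y = nat 1 ∧ ∃ a ∈ fst (snd y),
          TermVal (fst (snd (snd (snd y)))) s a ∧ TermVal (snd (snd (snd (snd y)))) s a) ∨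
        (fst y = nat 2 ∧ (s ∈ fst (snd (snd (snd y))) → s ∈ snd (snd (snd (snd y))))) ∨
        (fst y = nat 3 ∧ ∀ x ∈ fst (snd y),
          insert (ZFSet.pair (fst (snd (snd y))) x) s ∈ fst (snd (snd (snd y)))))) ∨
    (fst y = nat 4 ∧ s ∈ fst (snd y) ∧ {ZFSet.pair (nat 0) s} ∈ fst (snd (snd (snd y))))

section

variable {X n R S s : ZFSet.{u}}

theorem mem_op_mem : s ∈ op (tup (nat 0) X n R S) ↔ s ∈ seqs X n ∧
    ∃ a ∈ X, ∃ b ∈ X, TermVal R s a ∧ TermVal S s b ∧ a ∈ b := by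
  simp [op, tup]
  tauto

theorem mem_op_eq : s ∈ op (tup (nat 1) X n R S) ↔ s ∈ seqs X n ∧
    ∃ a ∈ X, TermVal R s a ∧ TermVal S s a := by
  simp [op, tup]
  tauto

theorem mem_op_imp : s ∈ op (tup (nat 2) X n R S) ↔ s ∈ seqs X n ∧ (s ∈ R → s ∈ S) := by
  simp [op, tup]
  tauto

theorem mem_op_all : s ∈ op (tup (nat 3) X n R S) ↔ s ∈ seqs X n ∧
    ∀ x ∈ X, insert (ZFSet.pair n x) s ∈ R := by
  simp [op, tup]
  tauto

theorem mem_op_slice : s ∈ op (tup (nat 4) X n R S) ↔ s ∈ X ∧ {ZFSet.pair (nat 0) s} ∈ R := by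
  simp [op, tup]
  tauto

end

section

variable {M : Set ZFSet.{u}} [InnerClass M] {n : ℕ} {s t r : (Fin n → ZFSet.{u}) → ZFSet.{u}}

instance DefRel.termVal [hs : DefFun M s] [ht : DefFun M t] [hr : DefFun M r] :
    DefRel M fun v => TermVal (s v) (t v) (r v) := by
  unfold TermVal
  infer_instance

set_option synthInstance.maxSize 2000 in
set_option synthInstance.maxHeartbeats 200000 in
instance DefFun.op [hs : DefFun M s] : DefFun M fun v => op (s v) := by
  refine DefFun.comp₁ (f := RelConstr.op) ?_ hs
  unfold RelConstr.op
  infer_instance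

end

/-- One step in the generation of the definable relations over `X`: all atomic relations and the
results of applying a connective or quantifier to relations in `F`. A relation `R` of arity `n` is
represented by the pair `⟨n, R⟩`. -/
noncomputable def relStep (X F : ZFSet.{u}) : ZFSet.{u} :=
  imageOf (fun y => ZFSet.pair (fst (snd (snd y))) (op y)) <|
    (ZFSet.prod (nat 4) (ZFSet.prod {X} (ZFSet.prod natSet
      (ZFSet.prod (insert ∅ (ZFSet.prod (nat 2) (natSet ∪ X) ∪ imageOf (fun y => snd y) F))
        (insert ∅ (ZFSet.prod (nat 2) (natSet ∪ X) ∪ imageOf (fun y => snd y) F)))))).sep fun y =>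
      fst y ∈ nat 2 ∨
      (fst y = nat 2 ∧ ZFSet.pair (fst (snd (snd y))) (fst (snd (snd (snd y)))) ∈ F ∧
        ZFSet.pair (fst (snd (snd y))) (snd (snd (snd (snd y)))) ∈ F) ∨
      (fst y = nat 3 ∧ ZFSet.pair (insert (fst (snd (snd y))) (fst (snd (snd y))))
        (fst (snd (snd (snd y)))) ∈ F)

/-- The relations over `X` generated at a stage `x`. -/
noncomputable def relStage (X x : ZFSet.{u}) : ZFSet.{u} :=
  memRec (fun X _ s => relStep X (ZFSet.sUnion (imageOf (fun y => snd y) s))) X x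

/-- The union of the relations over `X` generated at the stages in `x`. -/
noncomputable def relUnion (X x : ZFSet.{u}) : ZFSet.{u} :=
  ZFSet.sUnion (imageOf (fun y => relStage X y) x)

theorem relStage_eq (X x : ZFSet.{u}) : relStage X x = relStep X (relUnion X x) := by
  rw [relStage, memRec_eq, relUnion]
  congr 2
  ext z
  simp only [mem_imageOf, mem_graphOn]
  constructor
  · rintro ⟨p, ⟨y, hy, rfl⟩, rfl⟩
    exact ⟨y, hy, by simp [relStage]⟩
  · rintro ⟨y, hy, rfl⟩
    exact ⟨_, ⟨y, hy, rfl⟩, by simp [relStage]⟩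

section

variable {M : Set ZFSet.{u}} [InnerClass M] {n : ℕ} {s t r : (Fin n → ZFSet.{u}) → ZFSet.{u}}

set_option synthInstance.maxSize 2000 in
set_option synthInstance.maxHeartbeats 200000 in
instance DefFun.relStep [hs : DefFun M s] [ht : DefFun M t] :
    DefFun M fun v => relStep (s v) (t v) := by
  refine DefFun.comp₂ (f := RelConstr.relStep) ?_ hs ht
  unfold RelConstr.relStep
  infer_instance

instance DefFun.relStage [hs : DefFun M s] [ht : DefFun M t] :
    DefFun M fun v => relStage (s v) (t v) := by
  unfold RelConstr.relStage
  infer_instance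

instance DefFun.relUnion [hs : DefFun M s] [ht : DefFun M t] :
    DefFun M fun v => relUnion (s v) (t v) := by
  refine DefFun.comp₂ (f := RelConstr.relUnion) ?_ hs ht
  unfold RelConstr.relUnion
  infer_instance

end


theorem mem_relUnion {X x d : ZFSet.{u}} : d ∈ relUnion X x ↔ ∃ y ∈ x, d ∈ relStage X y := by
  simp only [relUnion, ZFSet.mem_sUnion, mem_imageOf]
  exact ⟨fun ⟨_, ⟨y, hy, e⟩, h⟩ => ⟨y, hy, e ▸ h⟩, fun ⟨y, hy, h⟩ => ⟨_, ⟨y, hy, rfl⟩, h⟩⟩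

/-- The values of a fixed term are definable over `X`. -/
theorem DefRel.termVal_enc {X : ZFSet.{u}} (c : ZFSet.{u}) {n m : ℕ} (ρ : Fin n → Fin m)
    (j : Fin m) :
    DefRel (X : Set ZFSet.{u}) fun w : Fin m → ZFSet.{u} =>
      TermVal c (enc fun i => w (ρ i)) (w j) := by
  by_cases h0 : c = ZFSet.pair (nat 0) (snd c)
  · have h1 : ∀ u, c ≠ ZFSet.pair (nat 1) u := by
      intro u hu
      rw [h0, ZFSet.pair_inj, nat_inj] at hu
      exact absurd hu.1 (by decide)
    by_cases h2 : ∃ i : Fin n, snd c = nat i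
    · obtain ⟨i, hi⟩ := h2
      refine (DefRel.var_eq_var j (ρ i)).congr fun w _ => ?_
      rw [TermVal, ← h0, hi, pair_mem_enc]
      simp only [h1, or_false, true_and, nat_inj]
      refine ⟨fun h => ⟨i, rfl, h⟩, fun ⟨k, hk, h⟩ => ?_⟩
      rw [h, Fin.ext hk]
    · have : DefRel (X : Set ZFSet.{u}) fun _ : Fin m → ZFSet.{u} => False := inferInstance
      refine this.congr fun w _ => ?_
      rw [TermVal, pair_mem_enc]
      simp only [h1, or_false, false_iff, not_and, not_exists]
      exact fun _ i hi => absurd ⟨i, hi⟩ h2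
  · by_cases h1 : ∃ p ∈ X, c = ZFSet.pair (nat 1) p
    · obtain ⟨p, hp, rfl⟩ := h1
      refine (DefRel.var_eq_const j (c := p) hp).congr fun w _ => ?_
      simp only [TermVal, h0, false_and, false_or, ZFSet.pair_inj, true_and, eq_comm]
    · have : DefRel (X : Set ZFSet.{u}) fun _ : Fin m → ZFSet.{u} => False := inferInstance
      refine this.congr fun w hw => ?_
      simp only [TermVal, h0, false_and, false_or, false_iff]
      exact fun h => h1 ⟨w j, hw j, h⟩

/-- Every generated relation over `X` is definable over `(X, ∈)`. -/
theorem defRel_of_mem_relStage {X x d : ZFSet.{u}} (h : d ∈ relStage X x) :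
    ∃ (n : ℕ) (R : ZFSet.{u}), d = ZFSet.pair (nat n) R ∧
      DefRel (X : Set ZFSet.{u}) fun v : Fin n → ZFSet.{u} => enc v ∈ R := by
  induction x using ZFSet.inductionOn generalizing d with
  | h x ih =>
    have ihF : ∀ (n : ℕ) (R : ZFSet.{u}), ZFSet.pair (nat n) R ∈ relUnion X x →
        DefRel (X : Set ZFSet.{u}) fun v : Fin n → ZFSet.{u} => enc v ∈ R := by
      intro n R hR
      obtain ⟨y, hy, h⟩ := mem_relUnion.1 hR
      obtain ⟨m, S, e, hS⟩ := ih y hy h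
      rw [ZFSet.pair_inj, nat_inj] at e
      obtain ⟨rfl, rfl⟩ := e
      exact hS
    rw [relStage_eq, relStep, mem_imageOf] at h
    obtain ⟨y, hy, rfl⟩ := h
    rw [ZFSet.mem_sep] at hy
    obtain ⟨hy, hF⟩ := hy
    obtain ⟨i, hi, y₁, hy₁, rfl⟩ := ZFSet.mem_prod.1 hy
    obtain ⟨X', hX', y₂, hy₂, rfl⟩ := ZFSet.mem_prod.1 hy₁
    obtain ⟨n, hn, y₃, hy₃, rfl⟩ := ZFSet.mem_prod.1 hy₂
    obtain ⟨R, -, S, -, rfl⟩ := ZFSet.mem_prod.1 hy₃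
    obtain rfl := ZFSet.mem_singleton.1 hX'
    obtain ⟨n, rfl⟩ := mem_natSet.1 hn
    simp only [fst_pair, snd_pair] at hF ⊢
    refine ⟨n, _, rfl, ?_⟩
    rcases hF with hi | ⟨rfl, hR, hS⟩ | ⟨rfl, hR⟩
    · obtain ⟨i, rfl⟩ := mem_nat.1 hi
      match i with
      | 0 =>
        have := DefRel.termVal_enc (X := X') R (fun i : Fin n => i.castSucc.castSucc)
          (Fin.last n).castSucc
        have := DefRel.termVal_enc (X := X') S (fun i : Fin n => i.castSucc.castSucc)
          (Fin.last (n + 1))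
        have : DefRel (X' : Set ZFSet.{u}) fun v : Fin n → ZFSet.{u} =>
            ∃ a ∈ (X' : Set ZFSet.{u}), ∃ b ∈ (X' : Set ZFSet.{u}),
              TermVal R (enc v) a ∧ TermVal S (enc v) b ∧ a ∈ b := inferInstance
        refine this.congr fun v hv => ?_
        refine Iff.trans ?_ mem_op_mem.symm
        exact (and_iff_right (enc_mem_seqs hv)).symm
      | 1 =>
        have := DefRel.termVal_enc (X := X') R (fun i : Fin n => i.castSucc) (Fin.last n)
        have := DefRel.termVal_enc (X := X') S (fun i : Fin n => i.castSucc) (Fin.last n)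
        have : DefRel (X' : Set ZFSet.{u}) fun v : Fin n → ZFSet.{u} =>
            ∃ a ∈ (X' : Set ZFSet.{u}), TermVal R (enc v) a ∧ TermVal S (enc v) a := inferInstance
        refine this.congr fun v hv => ?_
        refine Iff.trans ?_ mem_op_eq.symm
        exact (and_iff_right (enc_mem_seqs hv)).symm
    · have := ihF n R hR
      have := ihF n S hS
      have : DefRel (X' : Set ZFSet.{u}) fun v : Fin n → ZFSet.{u} => enc v ∈ R → enc v ∈ S :=
        inferInstance
      refine this.congr fun v hv => ?_
      refine Iff.trans ?_ mem_op_imp.symm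
      exact (and_iff_right (enc_mem_seqs hv)).symm
    · rw [insert_nat] at hR
      have := ihF (n + 1) R hR
      have : DefRel (X' : Set ZFSet.{u}) fun v : Fin n → ZFSet.{u} =>
          ∀ x ∈ (X' : Set ZFSet.{u}), enc (Fin.snoc v x : Fin (n + 1) → ZFSet.{u}) ∈ R := by
        refine DefRel.forallMem (hQ := ?_)
        refine this.congr fun w _ => ?_
        rw [← Fin.snoc_init_self w]
        simp
      refine this.congr fun v hv => ?_
      refine Iff.trans ?_ mem_op_all.symm
      simp only [enc_snoc]
      exact (and_iff_right (enc_mem_seqs hv)).symm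

/-- The set of sequences that satisfy a formula with parameters. -/
noncomputable def relSet {X : ZFSet.{u}} {n : ℕ}
    (φ : langSet.BoundedFormula (X : Set ZFSet.{u}) n) : ZFSet.{u} :=
  (seqs X (nat n)).sep fun s =>
    ∃ v : Fin n → (X : Set ZFSet.{u}), s = (enc fun i => (v i : ZFSet.{u})) ∧ φ.Realize id v

theorem enc_mem_relSet {X : ZFSet.{u}} {n : ℕ}
    {φ : langSet.BoundedFormula (X : Set ZFSet.{u}) n} (v : Fin n → (X : Set ZFSet.{u})) :
    (enc fun i => (v i : ZFSet.{u})) ∈ relSet φ ↔ φ.Realize id v := by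
  rw [relSet, ZFSet.mem_sep]
  constructor
  · rintro ⟨-, w, hw, h⟩
    have := enc_injective hw
    rwa [show v = w from funext fun i => Subtype.ext (congrFun this i)]
  · exact fun h => ⟨enc_mem_seqs fun i => (v i).2, v, rfl, h⟩

theorem relSet_eq {X : ZFSet.{u}} {n : ℕ} {φ : langSet.BoundedFormula (X : Set ZFSet.{u}) n}
    {R : ZFSet.{u}} (hR : R ⊆ seqs X (nat n)) (h : ∀ v : Fin n → (X : Set ZFSet.{u}),
      (enc fun i => (v i : ZFSet.{u})) ∈ R ↔ φ.Realize id v) : relSet φ = R := by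
  ext s
  constructor
  · intro hs
    obtain ⟨v, rfl, hv⟩ := (ZFSet.mem_sep.1 hs).2
    exact (h v).2 hv
  · intro hs
    obtain ⟨v, hv, rfl⟩ := mem_seqs.1 (hR hs)
    have := h fun i => ⟨v i, hv i⟩
    exact (enc_mem_relSet fun i => ⟨v i, hv i⟩).2 (this.1 hs)

/-- The codes of terms over `X`. The empty set is a code without value. -/
def IsCode (X c : ZFSet.{u}) : Prop :=
  c = ∅ ∨ (∃ i : ℕ, c = ZFSet.pair (nat 0) (nat i)) ∨ ∃ p ∈ X, c = ZFSet.pair (nat 1) p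

theorem exists_code {X : ZFSet.{u}} {n : ℕ} (t : langSet.Term ((X : Set ZFSet.{u}) ⊕ Fin n)) :
    ∃ c, IsCode X c ∧ ∀ (v : Fin n → (X : Set ZFSet.{u})) (a : ZFSet.{u}),
      TermVal c (enc fun i => (v i : ZFSet.{u})) a ↔ a = (t.realize (Sum.elim id v)).1 := by
  match t with
  | Term.var (Sum.inl p) =>
    refine ⟨ZFSet.pair (nat 1) p, Or.inr (Or.inr ⟨p, p.2, rfl⟩), fun v a => ?_⟩
    simp [TermVal, eq_comm]
  | Term.var (Sum.inr i) =>
    refine ⟨ZFSet.pair (nat 0) (nat i), Or.inr (Or.inl ⟨i, rfl⟩), fun v a => ?_⟩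
    simp only [TermVal, snd_pair, pair_mem_enc, ZFSet.pair_inj, nat_inj, true_and, Term.realize_var,
      Sum.elim_inr, zero_ne_one, false_and, or_false]
    exact ⟨fun ⟨j, hj, h⟩ => by rw [h, Fin.ext hj], fun h => ⟨i, rfl, h⟩⟩
  | Term.func f _ => exact f.elim

/-- The relations defined by formulas are generated by the operations. -/
theorem relSet_induction {X : ZFSet.{u}} {Q : ℕ → ZFSet.{u} → Prop}
    (hmem : ∀ n R S, IsCode X R → IsCode X S → Q n (op (tup (nat 0) X (nat n) R S)))
    (heq : ∀ n R S, IsCode X R → IsCode X S → Q n (op (tup (nat 1) X (nat n) R S)))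
    (himp : ∀ n R S, Q n R → Q n S → Q n (op (tup (nat 2) X (nat n) R S)))
    (hall : ∀ n R, Q (n + 1) R → Q n (op (tup (nat 3) X (nat n) R ∅)))
    {n : ℕ} (φ : langSet.BoundedFormula (X : Set ZFSet.{u}) n) : Q n (relSet φ) := by
  have hs : ∀ {n : ℕ} (v : Fin n → (X : Set ZFSet.{u})),
      (enc fun i => (v i : ZFSet.{u})) ∈ seqs X (nat n) := fun v => enc_mem_seqs fun i => (v i).2
  induction φ with
  | @falsum n =>
    rw [relSet_eq (R := op (tup (nat 0) X (nat n) ∅ ∅))]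
    · exact hmem _ _ _ (Or.inl rfl) (Or.inl rfl)
    · exact fun s hs => (mem_op_mem.1 hs).1
    · intro v
      refine iff_of_false (fun h => ?_) id
      obtain ⟨-, a, -, b, -, h, -⟩ := mem_op_mem.1 h
      have hne : ∀ x y : ZFSet.{u}, ∅ ≠ ZFSet.pair x y := fun x y h =>
        ZFSet.notMem_empty {x} (by rw [h]; simp [ZFSet.pair])
      rcases h with h | h
      · exact hne _ _ h.1
      · exact hne _ _ h
  | @equal n t₁ t₂ =>
    obtain ⟨c, hc, hcv⟩ := exists_code t₁
    obtain ⟨d, hd, hdv⟩ := exists_code t₂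
    rw [relSet_eq (R := op (tup (nat 1) X (nat n) c d))]
    · exact heq _ _ _ hc hd
    · exact fun s hs => (mem_op_eq.1 hs).1
    · intro v
      rw [mem_op_eq, and_iff_right (hs v)]
      simp only [hcv, hdv]
      refine Iff.trans ?_ Subtype.ext_iff.symm
      exact ⟨fun ⟨a, _, h1, h2⟩ => h1.symm.trans h2, fun h => ⟨_, Subtype.property _, rfl, h⟩⟩
  | @rel n l R ts =>
    cases R
    obtain ⟨c, hc, hcv⟩ := exists_code (ts 0)
    obtain ⟨d, hd, hdv⟩ := exists_code (ts 1)
    rw [relSet_eq (R := op (tup (nat 0) X (nat n) c d))]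
    · exact hmem _ _ _ hc hd
    · exact fun s hs => (mem_op_mem.1 hs).1
    · intro v
      rw [mem_op_mem, and_iff_right (hs v)]
      simp only [hcv, hdv]
      change _ ↔ ((ts 0).realize (Sum.elim id v)).1 ∈ ((ts 1).realize (Sum.elim id v)).1
      exact ⟨fun ⟨a, _, b, _, h1, h2, h⟩ => h1 ▸ h2 ▸ h,
        fun h => ⟨_, Subtype.property _, _, Subtype.property _, rfl, rfl, h⟩⟩
  | @imp n φ ψ ihφ ihψ =>
    rw [relSet_eq (R := op (tup (nat 2) X (nat n) (relSet φ) (relSet ψ)))]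
    · exact himp _ _ _ ihφ ihψ
    · exact fun s hs => (mem_op_imp.1 hs).1
    · intro v
      rw [mem_op_imp, and_iff_right (hs v), enc_mem_relSet, enc_mem_relSet,
        BoundedFormula.realize_imp]
  | @all n φ ih =>
    rw [relSet_eq (R := op (tup (nat 3) X (nat n) (relSet φ) ∅))]
    · exact hall _ _ ih
    · exact fun s hs => (mem_op_all.1 hs).1
    · intro v
      rw [mem_op_all, and_iff_right (hs v), BoundedFormula.realize_all]
      have : ∀ x : (X : Set ZFSet.{u}),
          insert (ZFSet.pair (nat n) x.1) (enc fun i => (v i : ZFSet.{u}))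
          = enc fun i => ((Fin.snoc v x : Fin (n + 1) → (X : Set ZFSet.{u})) i : ZFSet.{u}) := by
        intro x
        rw [← enc_snoc]
        congr 1
        ext1 i
        refine Fin.lastCases ?_ (fun i => ?_) i <;> simp
      constructor
      · intro h x
        rw [← enc_mem_relSet, ← this]
        exact h x.1 x.2
      · intro h x hx
        have h := h ⟨x, hx⟩
        rw [← enc_mem_relSet, ← this] at h
        exact h

/-- The relation defined by a formula is generated at a finite stage. -/
theorem exists_relSet_mem_relStage {X : ZFSet.{u}} {n : ℕ}
    (φ : langSet.BoundedFormula (X : Set ZFSet.{u}) n) :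
    ZFSet.pair (nat n) (relSet φ) ∈ relUnion X natSet := by
  -- closure of the stages under a single application of the generating operations
  have hstep : ∀ (i : Fin 4) (n k : ℕ) (R S : ZFSet.{u}),
      (IsCode X R ∨ R ∈ imageOf (fun y => snd y) (relUnion X (nat k))) →
      (IsCode X S ∨ S ∈ imageOf (fun y => snd y) (relUnion X (nat k))) →
      (i.1 < 2 ∨ (i.1 = 2 ∧ ZFSet.pair (nat n) R ∈ relUnion X (nat k) ∧
        ZFSet.pair (nat n) S ∈ relUnion X (nat k)) ∨
        (i.1 = 3 ∧ ZFSet.pair (nat (n + 1)) R ∈ relUnion X (nat k))) →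
      ZFSet.pair (nat n) (op (tup (nat i) X (nat n) R S)) ∈ relStage X (nat k) := by
    intro i n k R S hR hS h
    have hB : ∀ T, (IsCode X T ∨ T ∈ imageOf (fun y => snd y) (relUnion X (nat k))) →
        T ∈ (insert ∅ (ZFSet.prod (nat 2) (natSet ∪ X) ∪
          imageOf (fun y => snd y) (relUnion X (nat k))) : ZFSet.{u}) := by
      intro T hT
      rw [ZFSet.mem_insert_iff, ZFSet.mem_union]
      rcases hT with (hT | ⟨j, rfl⟩ | ⟨p, hp, rfl⟩) | hT
      · exact Or.inl hT
      · exact Or.inr (Or.inl (ZFSet.pair_mem_prod.2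
          ⟨nat_mem_nat.2 (by decide), ZFSet.mem_union.2 (Or.inl (nat_mem_natSet j))⟩))
      · exact Or.inr (Or.inl (ZFSet.pair_mem_prod.2
          ⟨nat_mem_nat.2 (by decide), ZFSet.mem_union.2 (Or.inr hp)⟩))
      · exact Or.inr (Or.inr hT)
    rw [relStage_eq, relStep, mem_imageOf]
    refine ⟨tup (nat i) X (nat n) R S, ZFSet.mem_sep.2 ⟨?_, ?_⟩, by simp [tup]⟩
    · simp only [tup, ZFSet.pair_mem_prod, ZFSet.mem_singleton, true_and]
      exact ⟨nat_mem_nat.2 i.2, nat_mem_natSet n, hB R hR, hB S hS⟩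
    · simp only [tup, fst_pair, snd_pair, insert_nat, nat_mem_nat, nat_inj]
      exact h
  have hmono : ∀ {k l : ℕ} {d : ZFSet.{u}}, k ≤ l → d ∈ relUnion X (nat k) →
      d ∈ relUnion X (nat l) := by
    intro k l d hkl hd
    obtain ⟨y, hy, hd⟩ := mem_relUnion.1 hd
    obtain ⟨i, rfl⟩ := mem_nat.1 hy
    exact mem_relUnion.2 ⟨_, nat_mem_nat.2 (i.2.trans_le hkl), hd⟩
  have hsucc : ∀ {k : ℕ} {d : ZFSet.{u}}, d ∈ relStage X (nat k) → d ∈ relUnion X (nat (k + 1)) :=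
    fun h => mem_relUnion.2 ⟨_, nat_mem_nat.2 (Nat.lt_succ_self _), h⟩
  have hsnd : ∀ {n k : ℕ} {R : ZFSet.{u}}, ZFSet.pair (nat n) R ∈ relUnion X (nat k) →
      R ∈ imageOf (fun y => snd y) (relUnion X (nat k)) :=
    fun h => mem_imageOf.2 ⟨_, h, by simp⟩
  have : ∃ k, ZFSet.pair (nat n) (relSet φ) ∈ relUnion X (nat k) := by
    refine relSet_induction (Q := fun n R => ∃ k, ZFSet.pair (nat n) R ∈ relUnion X (nat k))
      ?_ ?_ ?_ ?_ φ
    · exact fun n R S hR hS =>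
        ⟨1, hsucc (hstep 0 n 0 R S (Or.inl hR) (Or.inl hS) (Or.inl (by decide)))⟩
    · exact fun n R S hR hS =>
        ⟨1, hsucc (hstep 1 n 0 R S (Or.inl hR) (Or.inl hS) (Or.inl (by decide)))⟩
    · rintro n R S ⟨k, hR⟩ ⟨l, hS⟩
      have hR := hmono (le_max_left k l) hR
      have hS := hmono (le_max_right k l) hS
      exact ⟨_, hsucc (hstep 2 n _ R S (Or.inr (hsnd hR)) (Or.inr (hsnd hS))
        (Or.inr (Or.inl ⟨rfl, hR, hS⟩)))⟩
    · rintro n R ⟨k, hR⟩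
      exact ⟨_, hsucc (hstep 3 n k R ∅ (Or.inr (hsnd hR)) (Or.inl (Or.inl rfl))
        (Or.inr (Or.inr ⟨rfl, hR⟩)))⟩
  obtain ⟨k, hk⟩ := this
  obtain ⟨y, hy, hd⟩ := mem_relUnion.1 hk
  obtain ⟨i, rfl⟩ := mem_nat.1 hy
  exact mem_relUnion.2 ⟨_, nat_mem_natSet _, hd⟩

theorem eq_op_relSet {X y : ZFSet.{u}} (hy : y ⊆ X)
    {φ : langSet.BoundedFormula (X : Set ZFSet.{u}) 1}
    (hφ : ∀ v : Fin 1 → (X : Set ZFSet.{u}), φ.Realize id v ↔ (v 0 : ZFSet.{u}) ∈ y) :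
    y = op (tup (nat 4) X (nat 1) (relSet φ) ∅) := by
  ext z
  rw [mem_op_slice]
  have h : ∀ hz : z ∈ X, {ZFSet.pair (nat 0) z} ∈ relSet φ ↔ z ∈ y := by
    intro hz
    have := enc_mem_relSet (φ := φ) fun _ => ⟨z, hz⟩
    rw [enc_one, hφ] at this
    exact this
  exact ⟨fun hz => ⟨hy hz, (h (hy hz)).2 hz⟩, fun ⟨hz, h'⟩ => (h hz).1 h'⟩

/-- The definable power set in terms of the generated relations. -/
theorem defPow_eq (X : ZFSet.{u}) : defPow X =
    imageOf (fun d => op (tup (nat 4) X (nat 1) (snd d) ∅))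
      ((relUnion X natSet).sep fun d => fst d = nat 1) := by
  ext y
  rw [mem_defPow, mem_imageOf]
  constructor
  · rintro ⟨hy, ⟨φ, hφ⟩⟩
    refine ⟨ZFSet.pair (nat 1) (relSet φ),
      ZFSet.mem_sep.2 ⟨exists_relSet_mem_relStage φ, fst_pair _ _⟩, ?_⟩
    rw [snd_pair]
    exact eq_op_relSet hy hφ
  · rintro ⟨d, hd, rfl⟩
    obtain ⟨hd, h1⟩ := ZFSet.mem_sep.1 hd
    obtain ⟨x, -, hd⟩ := mem_relUnion.1 hd
    obtain ⟨n, R, rfl, hR⟩ := defRel_of_mem_relStage hd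
    rw [fst_pair, nat_inj] at h1
    subst h1
    refine ⟨fun z hz => (mem_op_slice.1 hz).1, hR.congr fun v hv => ?_⟩
    rw [mem_op_slice, enc_one, snd_pair]
    exact (and_iff_right (hv 0)).symm

section

variable {M : Set ZFSet.{u}} [InnerClass M] {n : ℕ} {s t r : (Fin n → ZFSet.{u}) → ZFSet.{u}}

instance DefFun.tup {i q : (Fin n → ZFSet.{u}) → ZFSet.{u}} [hi : DefFun M i] [hs : DefFun M s]
    [ht : DefFun M t] [hr : DefFun M r] [hq : DefFun M q] :
    DefFun M fun v => tup (i v) (s v) (t v) (r v) (q v) := by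
  unfold RelConstr.tup
  infer_instance

instance DefFun.defPow [hs : DefFun M s] : DefFun M fun v => defPow (s v) := by
  refine DefFun.comp₁ (f := RelConstr.defPow) ?_ hs
  simp only [defPow_eq]
  infer_instance

/-- The hierarchy `x ↦ L_{rank x}(A)` as a recursion along membership. -/
theorem lStage_rank (A x : ZFSet.{u}) : lStage A x.rank =
    memRec (fun p x s => p ∪ ZFSet.sUnion (imageOf (fun y => defPow (app s y)) x)) (trcl A) x := by
  induction x using ZFSet.inductionOn with
  | h x ih =>
    rw [memRec_eq]
    ext z
    rw [mem_lStage, ZFSet.mem_union, ZFSet.mem_sUnion]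
    refine or_congr_right ?_
    constructor
    · rintro ⟨β, hβ, hz⟩
      obtain ⟨y, hy, hβy⟩ := ZFSet.lt_rank_iff.1 hβ
      refine ⟨_, mem_imageOf.2 ⟨y, hy, rfl⟩, ?_⟩
      rw [app_graphOn hy, ← ih y hy, ← lStage_add_one]
      rw [← lStage_add_one] at hz
      exact lStage_mono A (by gcongr) hz
    · rintro ⟨w, hw, hz⟩
      obtain ⟨y, hy, rfl⟩ := mem_imageOf.1 hw
      rw [app_graphOn hy, ← ih y hy] at hz
      exact ⟨y.rank, ZFSet.rank_lt_of_mem hy, hz⟩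

instance DefFun.lStage_rank {A : ZFSet.{u}} [hA : InClass M (trcl A)] [hs : DefFun M s] :
    DefFun M fun v => lStage A (s v).rank := by
  simp only [RelConstr.lStage_rank]
  infer_instance

end

end RelConstr

/-! ### Ordinal arithmetic in an inner model -/

namespace RelConstr

/-- Ordinal addition on von Neumann ordinals. -/
noncomputable def ordAdd (a b : ZFSet.{u}) : ZFSet.{u} :=
  memRec (fun p x s => p ∪ imageOf (fun y => app s y) x) a b

/-- Ordinal multiplication on von Neumann ordinals. -/
noncomputable def ordMul (a b : ZFSet.{u}) : ZFSet.{u} :=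
  memRec (fun p x s => ZFSet.sUnion (imageOf (fun y => ordAdd (app s y) p) x)) a b

theorem ordAdd_toZFSet (α β : Ordinal.{u}) : ordAdd α.toZFSet β.toZFSet = (α + β).toZFSet := by
  induction β using WellFoundedLT.induction with
  | ind β ih =>
    have h : ∀ γ < β, app (graphOn (ordAdd α.toZFSet) β.toZFSet) γ.toZFSet = (α + γ).toZFSet :=
      fun γ hγ => by rw [app_graphOn (Ordinal.toZFSet_mem_toZFSet_iff.2 hγ), ih γ hγ]
    rw [ordAdd, memRec_eq]
    change _ ∪ imageOf (fun y => app (graphOn (ordAdd α.toZFSet) β.toZFSet) y) _ = _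
    ext z
    simp only [ZFSet.mem_union, mem_imageOf, Ordinal.mem_toZFSet_iff]
    constructor
    · rintro (⟨γ, hγ, rfl⟩ | ⟨_, ⟨γ, hγ, rfl⟩, rfl⟩)
      · exact ⟨γ, hγ.trans_le le_self_add, rfl⟩
      · exact ⟨α + γ, by gcongr, (h γ hγ).symm⟩
    · rintro ⟨γ, hγ, rfl⟩
      rcases lt_or_ge γ α with h' | h'
      · exact Or.inl ⟨γ, h', rfl⟩
      · refine Or.inr ⟨_, ⟨γ - α, Ordinal.sub_lt_of_lt_add hγ ?_, rfl⟩, ?_⟩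
        · by_contra! h0
          rw [nonpos_iff_eq_zero.1 h0, add_zero] at hγ
          exact absurd hγ h'.not_gt
        · have hlt : γ - α < β := by
            rw [← add_lt_add_iff_left α, Ordinal.add_sub_cancel_of_le h']
            exact hγ
          rw [h _ hlt, Ordinal.add_sub_cancel_of_le h']

theorem ordMul_toZFSet (α β : Ordinal.{u}) : ordMul α.toZFSet β.toZFSet = (α * β).toZFSet := by
  induction β using WellFoundedLT.induction with
  | ind β ih =>
    have h : ∀ γ < β, ordAdd (app (graphOn (ordMul α.toZFSet) β.toZFSet) γ.toZFSet) α.toZFSet =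
        (α * γ + α).toZFSet := fun γ hγ => by
      rw [app_graphOn (Ordinal.toZFSet_mem_toZFSet_iff.2 hγ), ih γ hγ, ordAdd_toZFSet]
    rw [ordMul, memRec_eq]
    change ZFSet.sUnion (imageOf
      (fun y => ordAdd (app (graphOn (ordMul α.toZFSet) β.toZFSet) y) α.toZFSet) _) = _
    ext z
    simp only [ZFSet.mem_sUnion, mem_imageOf, Ordinal.mem_toZFSet_iff (o := β)]
    constructor
    · rintro ⟨_, ⟨_, ⟨γ, hγ, rfl⟩, rfl⟩, hz⟩
      rw [h γ hγ, ← mul_add_one] at hz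
      exact Ordinal.toZFSet_subset_toZFSet_iff.2
        (mul_le_mul_right (Order.add_one_le_of_lt hγ) α) hz
    · intro hz
      obtain ⟨γ, hγ, rfl⟩ := Ordinal.mem_toZFSet_iff.1 hz
      have hα : α ≠ 0 := by
        rintro rfl
        simp at hγ
      have hlt : γ / α < β := (Ordinal.lt_mul_iff_div_lt hα).1 hγ
      refine ⟨_, ⟨_, ⟨γ / α, hlt, rfl⟩, rfl⟩, ?_⟩
      rw [h _ hlt, Ordinal.toZFSet_mem_toZFSet_iff]
      exact Ordinal.lt_mul_div_add γ hα

/-- A pairing of ordinals. -/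
noncomputable def ordPair (α β : Ordinal.{u}) : Ordinal.{u} := (α + β) * (α + β) + α

theorem ordPair_lt {α β γ δ : Ordinal.{u}} (h : α + β < γ + δ) : ordPair α β < ordPair γ δ := by
  have h1 : α + β + 1 ≤ γ + δ := Order.add_one_le_of_lt h
  unfold ordPair
  generalize γ + δ = τ at h1 ⊢
  calc (α + β) * (α + β) + α ≤ (α + β) * (α + β) + (α + β) := by gcongr; exact le_self_add
    _ < (α + β) * (α + β) + (α + β) + 1 := Order.lt_add_one_iff.2 le_rfl
    _ = (α + β) * (α + β) + (α + β + 1) := add_assoc _ _ _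
    _ ≤ (α + β + 1) * (α + β) + (α + β + 1) := by
        gcongr (?_ * (α + β)) + _
        exact le_self_add
    _ = (α + β + 1) * (α + β + 1) := (mul_add_one _ _).symm
    _ ≤ τ * τ := by gcongr
    _ ≤ τ * τ + γ := le_self_add

theorem ordPair_inj {α β γ δ : Ordinal.{u}} (h : ordPair α β = ordPair γ δ) : α = γ ∧ β = δ := by
  have h1 : α + β = γ + δ := by
    rcases lt_trichotomy (α + β) (γ + δ) with h' | h' | h'
    · exact absurd h (ordPair_lt h').ne
    · exact h'
    · exact absurd h (ordPair_lt h').ne'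
  have h2 : α = γ := by
    rw [ordPair, ordPair, h1] at h
    exact add_left_cancel h
  exact ⟨h2, by rw [h2] at h1; exact add_left_cancel h1⟩

theorem le_ordPair (α β : Ordinal.{u}) : α ≤ ordPair α β ∧ β ≤ ordPair α β := by
  have h : α + β ≤ ordPair α β := by
    rcases eq_or_ne (α + β) 0 with h | h
    · rw [h]
      exact zero_le
    · exact (Ordinal.le_mul_left _ (pos_iff_ne_zero.2 h)).trans le_self_add
  exact ⟨le_self_add.trans h, le_add_self.trans h⟩

/-- `x` is the successor of the ordinal that codes the pair of the ordinals `a` and `b`. The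
successor makes the code larger than both coordinates. -/
def IsPairCode (x a b : ZFSet.{u}) : Prop :=
  x = insert (ordAdd (ordMul (ordAdd a b) (ordAdd a b)) a)
    (ordAdd (ordMul (ordAdd a b) (ordAdd a b)) a)

theorem isPairCode_toZFSet {ξ α β : Ordinal.{u}} :
    IsPairCode ξ.toZFSet α.toZFSet β.toZFSet ↔ ξ = ordPair α β + 1 := by
  rw [IsPairCode, ordAdd_toZFSet, ordMul_toZFSet, ordAdd_toZFSet, ← Ordinal.toZFSet_add_one,
    Ordinal.toZFSet_injective.eq_iff, ordPair]

/-- The first coordinate of the pair of ordinals with code `x`. -/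
noncomputable def ordFst (x : ZFSet.{u}) : ZFSet.{u} := leastOrd fun a => ∃ b ∈ x, IsPairCode x a b

/-- The second coordinate of the pair of ordinals with code `x`. -/
noncomputable def ordSnd (x : ZFSet.{u}) : ZFSet.{u} := leastOrd fun b => ∃ a ∈ x, IsPairCode x a b

theorem ordFst_toZFSet (α β : Ordinal.{u}) : ordFst (ordPair α β + 1).toZFSet = α.toZFSet := by
  have hlt : β < ordPair α β + 1 := Order.lt_add_one_iff.2 (le_ordPair α β).2
  obtain ⟨b, hb, h⟩ := leastOrd_spec (P := fun a => ∃ b ∈ (ordPair α β + 1).toZFSet,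
    IsPairCode (ordPair α β + 1).toZFSet a b) (α := α)
    ⟨_, Ordinal.toZFSet_mem_toZFSet_iff.2 hlt, isPairCode_toZFSet.2 rfl⟩
  obtain ⟨γ, -, rfl⟩ := Ordinal.mem_toZFSet_iff.1 hb
  rw [leastOrd, isPairCode_toZFSet] at h
  rw [ordFst, leastOrd, ← (ordPair_inj (Order.succ_injective h)).1]

theorem ordSnd_toZFSet (α β : Ordinal.{u}) : ordSnd (ordPair α β + 1).toZFSet = β.toZFSet := by
  have hlt : α < ordPair α β + 1 := Order.lt_add_one_iff.2 (le_ordPair α β).1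
  obtain ⟨b, hb, h⟩ := leastOrd_spec (P := fun b => ∃ a ∈ (ordPair α β + 1).toZFSet,
    IsPairCode (ordPair α β + 1).toZFSet a b) (α := β)
    ⟨_, Ordinal.toZFSet_mem_toZFSet_iff.2 hlt, isPairCode_toZFSet.2 rfl⟩
  obtain ⟨γ, -, rfl⟩ := Ordinal.mem_toZFSet_iff.1 hb
  rw [leastOrd, isPairCode_toZFSet] at h
  rw [ordSnd, leastOrd, ← (ordPair_inj (Order.succ_injective h)).2]

section

variable {M : Set ZFSet.{u}} [InnerClass M] {n : ℕ} {s t r : (Fin n → ZFSet.{u}) → ZFSet.{u}}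

instance DefFun.ordAdd [hs : DefFun M s] [ht : DefFun M t] :
    DefFun M fun v => ordAdd (s v) (t v) := by
  unfold RelConstr.ordAdd
  infer_instance

instance DefFun.ordMul [hs : DefFun M s] [ht : DefFun M t] :
    DefFun M fun v => ordMul (s v) (t v) := by
  unfold RelConstr.ordMul
  infer_instance

instance DefRel.isPairCode [hs : DefFun M s] [ht : DefFun M t] [hr : DefFun M r] :
    DefRel M fun v => IsPairCode (s v) (t v) (r v) := by
  unfold IsPairCode
  infer_instance

instance DefFun.ordFst [hs : DefFun M s] : DefFun M fun v => ordFst (s v) := by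
  refine DefFun.comp₁ (f := RelConstr.ordFst) ?_ hs
  unfold RelConstr.ordFst
  infer_instance

instance DefFun.ordSnd [hs : DefFun M s] : DefFun M fun v => ordSnd (s v) := by
  refine DefFun.comp₁ (f := RelConstr.ordSnd) ?_ hs
  unfold RelConstr.ordSnd
  infer_instance

end

end RelConstr

/-! ### A definable enumeration by ordinals and elements of `V_{λ+1}` -/

namespace RelConstr

theorem trcl_eq_self {A : ZFSet.{u}} (hA : A.IsTransitive) : trcl A = A :=
  le_antisymm (trcl_subset hA fun _ h => h) (subset_trcl A)

theorem trcl_mem_lClass (A : ZFSet.{u}) : trcl A ∈ lClass A :=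
  ⟨0 + 1, by simpa [lStage_zero] using lStage_mem A 0⟩

section Coding

variable {lam : Ordinal.{u}}

theorem pair_mem_vonNeumann (hlam : Order.IsSuccLimit lam) {a b : ZFSet.{u}}
    (ha : a ∈ ZFSet.vonNeumann lam) (hb : b ∈ ZFSet.vonNeumann lam) :
    ZFSet.pair a b ∈ ZFSet.vonNeumann lam := by
  rw [ZFSet.mem_vonNeumann] at *
  rw [ZFSet.pair, ZFSet.rank_pair, ZFSet.rank_singleton, ZFSet.rank_pair]
  have := hlam.succ_lt ha
  have := hlam.succ_lt hb
  refine max_lt (hlam.succ_lt ‹_›) (hlam.succ_lt (max_lt ‹_› ‹_›))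

theorem mem_vonNeumann_add_one {x : ZFSet.{u}} :
    x ∈ ZFSet.vonNeumann (lam + 1) ↔ x ⊆ ZFSet.vonNeumann lam := by
  rw [ZFSet.vonNeumann_add_one, ZFSet.mem_powerset]

/-- A family of elements of `V_{λ+1}` indexed by elements of `V_λ` is coded by an element of
`V_{λ+1}`. -/
theorem exists_slice_eq (hlam : Order.IsSuccLimit lam) {I : ZFSet.{u}}
    (hI : I ⊆ ZFSet.vonNeumann lam) (a : ZFSet.{u} → ZFSet.{u})
    (ha : ∀ i ∈ I, a i ∈ ZFSet.vonNeumann (lam + 1)) :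
    ∃ c ∈ ZFSet.vonNeumann (lam + 1), ∀ i ∈ I, slice c i = a i := by
  refine ⟨(ZFSet.vonNeumann lam).sep fun p => ∃ i ∈ I, ∃ z ∈ a i, p = ZFSet.pair i z,
    mem_vonNeumann_add_one.2 ZFSet.sep_subset, fun i hi => ?_⟩
  ext z
  rw [mem_slice, ZFSet.mem_sep]
  constructor
  · rintro ⟨-, j, hj, w, hw, h⟩
    rw [ZFSet.pair_inj] at h
    rw [h.1, h.2]
    exact hw
  · intro hz
    exact ⟨pair_mem_vonNeumann hlam (hI hi) (mem_vonNeumann_add_one.1 (ha i hi) hz),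
      i, hi, z, hz, rfl⟩

theorem nat_mem_vonNeumann (hlam : Order.IsSuccLimit lam) (n : ℕ) :
    nat n ∈ ZFSet.vonNeumann lam := by
  rw [ZFSet.mem_vonNeumann, nat, Ordinal.rank_toZFSet]
  exact Ordinal.natCast_lt_of_isSuccLimit hlam n

theorem vonNeumann_subset_add_one {x : ZFSet.{u}} (hx : x ∈ ZFSet.vonNeumann lam) :
    x ∈ ZFSet.vonNeumann (lam + 1) :=
  ZFSet.vonNeumann_subset_of_le le_self_add hx

theorem exists_slice_nat (hlam : Order.IsSuccLimit lam) {a b c : ZFSet.{u}}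
    (ha : a ∈ ZFSet.vonNeumann (lam + 1)) (hb : b ∈ ZFSet.vonNeumann (lam + 1))
    (hc : c ∈ ZFSet.vonNeumann (lam + 1)) :
    ∃ d ∈ ZFSet.vonNeumann (lam + 1), slice d (nat 0) = a ∧ slice d (nat 1) = b ∧
      slice d (nat 2) = c := by
  classical
  obtain ⟨d, hd, h⟩ := exists_slice_eq hlam (I := nat 3) (fun i hi => by
      obtain ⟨j, rfl⟩ := mem_nat.1 hi
      exact nat_mem_vonNeumann hlam j)
    (fun i => if i = nat 0 then a else if i = nat 1 then b else c)
    (fun i _ => by split_ifs <;> assumption)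
  refine ⟨d, hd, ?_, ?_, ?_⟩
  · rw [h _ (nat_mem_nat.2 (by decide))]
    simp
  · rw [h _ (nat_mem_nat.2 (by decide))]
    simp
  · rw [h _ (nat_mem_nat.2 (by decide))]
    simp

end Coding

open Classical in
/-- The value at the parameter `c` of the function with index `x`, when `s` is the family of the
functions with smaller index. The first slice of `c` tells which of four kinds of objects is built:
the second slice of `c`, a stage of the hierarchy over `A`, an ordered pair of values of two earlier
functions, or the result of applying `op` to the value of an earlier function. -/
noncomputable def enumStep (A x s c : ZFSet.{u}) : ZFSet.{u} :=
  if slice c (nat 0) = nat 0 then slice c (nat 1)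
  else if slice c (nat 0) = nat 1 then lStage A (ordFst x).rank
  else if slice c (nat 0) = nat 2 then
    ZFSet.pair (app (app s (ordFst x)) (slice c (nat 1))) (app (app s (ordSnd x)) (slice c (nat 2)))
  else op (app (app s (ordFst x)) (slice c (nat 1)))

/-- The function on `A` with index `x`, as a set. -/
noncomputable def enumFam (A x : ZFSet.{u}) : ZFSet.{u} :=
  memRec (fun _ x s => graphOn (fun c => enumStep A x s c) A) ∅ x

/-- The value at `c` of the function with index `x`. For ordinals `x` and elements `c` of
`A = V_{λ+1}`, these are all elements of `L(A)`, see `exists_enum_eq`. -/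
noncomputable def enum (A x c : ZFSet.{u}) : ZFSet.{u} := app (enumFam A x) c

theorem enum_eq {A x c : ZFSet.{u}} (hc : c ∈ A) :
    enum A x c = enumStep A x (graphOn (enumFam A) x) c := by
  rw [enum, enumFam, memRec_eq, app_graphOn hc]
  rfl

theorem enumFam_congr {A x y : ZFSet.{u}} (h : y ∈ x) (c : ZFSet.{u}) :
    app (app (graphOn (enumFam A) x) y) c = enum A y c := by
  rw [app_graphOn h, enum]

section

variable {M : Set ZFSet.{u}} [InnerClass M] {n : ℕ} {s t r : (Fin n → ZFSet.{u}) → ZFSet.{u}}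
  {A : ZFSet.{u}}

instance DefFun.enumStep [InClass M (trcl A)] [hs : DefFun M s] [ht : DefFun M t]
    [hr : DefFun M r] : DefFun M fun v => enumStep A (s v) (t v) (r v) := by
  refine DefFun.comp₃ (f := RelConstr.enumStep A) ?_ hs ht hr
  unfold RelConstr.enumStep
  infer_instance

instance DefFun.enum [InClass M A] [InClass M (trcl A)] [hs : DefFun M s] [ht : DefFun M t] :
    DefFun M fun v => enum A (s v) (t v) := by
  unfold RelConstr.enum enumFam
  infer_instance

end

section Surjective

variable {lam : Ordinal.{u}}

/-- `x` is a value of one of the functions of the enumeration. -/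
def IsEnum (A x : ZFSet.{u}) : Prop := ∃ α : Ordinal.{u}, ∃ c ∈ A, enum A α.toZFSet c = x

theorem isEnum_of_mem (hlam : Order.IsSuccLimit lam) {a : ZFSet.{u}}
    (ha : a ∈ ZFSet.vonNeumann (lam + 1)) : IsEnum (ZFSet.vonNeumann (lam + 1)) a := by
  have h (k : ℕ) := vonNeumann_subset_add_one (nat_mem_vonNeumann hlam k)
  obtain ⟨c, hc, h0, h1, -⟩ := exists_slice_nat hlam (h 0) ha (h 0)
  refine ⟨0, c, hc, ?_⟩
  rw [enum_eq hc, enumStep, if_pos h0, h1]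

theorem isEnum_lStage (hlam : Order.IsSuccLimit lam) (α : Ordinal.{u}) :
    IsEnum (ZFSet.vonNeumann (lam + 1)) (lStage (ZFSet.vonNeumann (lam + 1)) α) := by
  have h (k : ℕ) := vonNeumann_subset_add_one (nat_mem_vonNeumann hlam k)
  obtain ⟨c, hc, h0, -, -⟩ := exists_slice_nat hlam (h 1) (h 0) (h 0)
  refine ⟨ordPair α 0 + 1, c, hc, ?_⟩
  rw [enum_eq hc, enumStep, if_neg (by rw [h0, nat_inj]; decide), if_pos h0, ordFst_toZFSet,
    Ordinal.rank_toZFSet]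

theorem isEnum_pair (hlam : Order.IsSuccLimit lam) {x y : ZFSet.{u}}
    (hx : IsEnum (ZFSet.vonNeumann (lam + 1)) x) (hy : IsEnum (ZFSet.vonNeumann (lam + 1)) y) :
    IsEnum (ZFSet.vonNeumann (lam + 1)) (ZFSet.pair x y) := by
  obtain ⟨α, a, ha, rfl⟩ := hx
  obtain ⟨β, b, hb, rfl⟩ := hy
  have h (k : ℕ) := vonNeumann_subset_add_one (nat_mem_vonNeumann hlam k)
  obtain ⟨c, hc, h0, h1, h2⟩ := exists_slice_nat hlam (h 2) ha hb
  refine ⟨ordPair α β + 1, c, hc, ?_⟩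
  have hα := Ordinal.toZFSet_mem_toZFSet_iff.2 (Order.lt_add_one_iff.2 (le_ordPair α β).1)
  have hβ := Ordinal.toZFSet_mem_toZFSet_iff.2 (Order.lt_add_one_iff.2 (le_ordPair α β).2)
  rw [enum_eq hc, enumStep, if_neg (by rw [h0, nat_inj]; decide),
    if_neg (by rw [h0, nat_inj]; decide), if_pos h0, ordFst_toZFSet, ordSnd_toZFSet, h1, h2,
    enumFam_congr hα, enumFam_congr hβ]

theorem isEnum_op (hlam : Order.IsSuccLimit lam) {x : ZFSet.{u}}
    (hx : IsEnum (ZFSet.vonNeumann (lam + 1)) x) : IsEnum (ZFSet.vonNeumann (lam + 1)) (op x) := by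
  obtain ⟨α, a, ha, rfl⟩ := hx
  have h (k : ℕ) := vonNeumann_subset_add_one (nat_mem_vonNeumann hlam k)
  obtain ⟨c, hc, h0, h1, -⟩ := exists_slice_nat hlam (h 3) ha (h 0)
  refine ⟨ordPair α 0 + 1, c, hc, ?_⟩
  have hα := Ordinal.toZFSet_mem_toZFSet_iff.2 (Order.lt_add_one_iff.2 (le_ordPair α 0).1)
  rw [enum_eq hc, enumStep, if_neg (by rw [h0, nat_inj]; decide),
    if_neg (by rw [h0, nat_inj]; decide), if_neg (by rw [h0, nat_inj]; decide), ordFst_toZFSet, h1,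
    enumFam_congr hα]

/-- Every element of `L(V_{λ+1})` is a value of the enumeration: the values include the stages,
and each definable subset of a stage is obtained from the stage and from finitely many of its
elements by the operations that the values are closed under. -/
theorem isEnum_of_mem_lClass (hlam : Order.IsSuccLimit lam) {x : ZFSet.{u}}
    (hx : x ∈ lClass (ZFSet.vonNeumann (lam + 1))) : IsEnum (ZFSet.vonNeumann (lam + 1)) x := by
  obtain ⟨α, hx⟩ := hx
  induction α using WellFoundedLT.induction generalizing x with
  | ind α ih =>
    rcases (mem_lStage _).1 hx with hx | ⟨β, hβ, hx⟩
    · rw [trcl_eq_self (ZFSet.isTransitive_vonNeumann _)] at hx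
      exact isEnum_of_mem hlam hx
    · obtain ⟨hsub, ⟨φ, hφ⟩⟩ := mem_defPow.1 hx
      have hX := isEnum_lStage hlam β
      have hnat : ∀ k, IsEnum (ZFSet.vonNeumann (lam + 1)) (nat k) := fun k =>
        isEnum_of_mem hlam (vonNeumann_subset_add_one (nat_mem_vonNeumann hlam k))
      have hempty : IsEnum (ZFSet.vonNeumann (lam + 1)) ∅ :=
        isEnum_of_mem hlam (mem_vonNeumann_add_one.2 (ZFSet.empty_subset _))
      have htup : ∀ {i n R S : ZFSet.{u}}, IsEnum (ZFSet.vonNeumann (lam + 1)) i →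
          IsEnum (ZFSet.vonNeumann (lam + 1)) n → IsEnum (ZFSet.vonNeumann (lam + 1)) R →
          IsEnum (ZFSet.vonNeumann (lam + 1)) S → IsEnum (ZFSet.vonNeumann (lam + 1))
            (op (tup i (lStage (ZFSet.vonNeumann (lam + 1)) β) n R S)) := fun hi hn hR hS =>
        isEnum_op hlam (isEnum_pair hlam hi (isEnum_pair hlam hX
          (isEnum_pair hlam hn (isEnum_pair hlam hR hS))))
      have hcode : ∀ {c}, IsCode (lStage (ZFSet.vonNeumann (lam + 1)) β) c →
          IsEnum (ZFSet.vonNeumann (lam + 1)) c := by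
        rintro c (rfl | ⟨i, rfl⟩ | ⟨p, hp, rfl⟩)
        · exact hempty
        · exact isEnum_pair hlam (hnat 0) (hnat i)
        · exact isEnum_pair hlam (hnat 1) (ih β hβ hp)
      have hrel : IsEnum (ZFSet.vonNeumann (lam + 1)) (relSet φ) :=
        relSet_induction (Q := fun _ R => IsEnum (ZFSet.vonNeumann (lam + 1)) R)
          (fun n R S hR hS => htup (hnat 0) (hnat n) (hcode hR) (hcode hS))
          (fun n R S hR hS => htup (hnat 1) (hnat n) (hcode hR) (hcode hS))
          (fun n R S hR hS => htup (hnat 2) (hnat n) hR hS)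
          (fun n R hR => htup (hnat 3) (hnat n) hR hempty) φ
      rw [eq_op_relSet hsub hφ]
      exact htup (hnat 4) (hnat 1) hrel hempty

end Surjective

end RelConstr

/-! ### Regularity of `Θ` -/

namespace RelConstr

instance (A : ZFSet.{u}) : InClass (lClass A) (trcl A) := ⟨trcl_mem_lClass A⟩

instance (α : Ordinal.{u}) : InClass (lClass (ZFSet.vonNeumann α)) (ZFSet.vonNeumann α) := by
  have := trcl_mem_lClass (ZFSet.vonNeumann α)
  rw [trcl_eq_self (ZFSet.isTransitive_vonNeumann α)] at this
  exact ⟨this⟩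

instance DefRel.isSurjFunc {M : Set ZFSet.{u}} [InnerClass M] {n : ℕ}
    {s t r : (Fin n → ZFSet.{u}) → ZFSet.{u}} [hs : DefFun M s] [ht : DefFun M t]
    [hr : DefFun M r] : DefRel M fun v => IsSurjFunc (s v) (t v) (r v) := by
  refine DefRel.comp₃ (R := IsSurjFunc) ?_ hs ht hr
  unfold IsSurjFunc
  infer_instance

section Surj

variable {M : Set ZFSet.{u}} [InnerClass M] {A : ZFSet.{u}}

/-- To obtain an ordinal as a surjective image of `A` in `M`, it suffices to cover it by the values
on `A` of a definable function. -/
theorem mem_surjOrdinals_of_defFun (hA : A ∈ M) {γ : Ordinal.{u}} (hγ : γ ≠ 0)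
    {t : ZFSet.{u} → ZFSet.{u}} (ht : DefFun M fun v : Fin 1 → ZFSet.{u} => t (v 0))
    (h : ∀ ξ < γ, ∃ c ∈ A, t c = ξ.toZFSet) : γ ∈ surjOrdinals M A := by
  classical
  have h0 : ∅ ∈ γ.toZFSet := by
    rw [← Ordinal.toZFSet_zero, Ordinal.toZFSet_mem_toZFSet_iff]
    exact pos_iff_ne_zero.2 hγ
  have hf : DefFun M fun v : Fin 1 → ZFSet.{u} => if t (v 0) ∈ γ.toZFSet then t (v 0) else ∅ := by
    convert (inferInstance : DefFun M fun v : Fin 1 → ZFSet.{u} =>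
      @ite _ (t (v 0) ∈ γ.toZFSet) (Classical.propDecidable _) (t (v 0)) ∅)
  refine ⟨_, graphOn_mem_class (f := fun c => if t c ∈ γ.toZFSet then t c else ∅) hf hA,
    isFunc_graphOn.2 fun c _ => ?_, fun b hb => ?_⟩
  · split_ifs with hc
    · exact hc
    · exact h0
  · obtain ⟨ξ, hξ, rfl⟩ := Ordinal.mem_toZFSet_iff.1 hb
    obtain ⟨c, hc, hct⟩ := h ξ hξ
    exact ⟨c, hc, pair_mem_graphOn.2 ⟨hc, by rw [hct, if_pos hb]⟩⟩

theorem mem_surjOrdinals_of_le (hA : A ∈ M) {β γ : Ordinal.{u}} (hγ : γ ∈ surjOrdinals M A)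
    (hβ : β ≠ 0) (h : β ≤ γ) : β ∈ surjOrdinals M A := by
  obtain ⟨f, hfM, hf, hs⟩ := hγ
  have : InClass M f := ⟨hfM⟩
  refine mem_surjOrdinals_of_defFun hA hβ (t := fun c => app f c) inferInstance fun ξ hξ => ?_
  obtain ⟨a, ha, hp⟩ := hs _ (Ordinal.toZFSet_mem_toZFSet_iff.2 (hξ.trans_le h))
  exact ⟨a, ha, app_eq_of_isFunc hf hp⟩

end Surj

section Theta

variable {lam : Ordinal.{u}}

theorem one_mem_surjOrdinals :
    1 ∈ surjOrdinals (lClass (ZFSet.vonNeumann (lam + 1))) (ZFSet.vonNeumann (lam + 1)) := by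
  refine mem_surjOrdinals_of_defFun InClass.mem one_ne_zero (t := fun _ => ∅) inferInstance
    fun ξ hξ => ⟨∅, mem_vonNeumann_add_one.2 (ZFSet.empty_subset _), ?_⟩
  rw [Order.lt_one_iff.1 hξ, Ordinal.toZFSet_zero]

theorem add_one_mem_surjOrdinals (hlam : Order.IsSuccLimit lam) {γ : Ordinal.{u}}
    (hγ : γ ∈ surjOrdinals (lClass (ZFSet.vonNeumann (lam + 1))) (ZFSet.vonNeumann (lam + 1))) :
    γ + 1 ∈ surjOrdinals (lClass (ZFSet.vonNeumann (lam + 1))) (ZFSet.vonNeumann (lam + 1)) := by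
  classical
  obtain ⟨f, hfM, hf, hs⟩ := hγ
  have : InClass (lClass (ZFSet.vonNeumann (lam + 1))) f := ⟨hfM⟩
  have hnat (k : ℕ) := vonNeumann_subset_add_one (nat_mem_vonNeumann hlam k)
  refine mem_surjOrdinals_of_defFun InClass.mem (by simp)
    (t := fun c => @ite _ (slice c (nat 0) = nat 0) (Classical.propDecidable _) γ.toZFSet
      (app f (slice c (nat 1)))) inferInstance fun ξ hξ => ?_
  rcases (Order.lt_add_one_iff.1 hξ).eq_or_lt with rfl | hξ
  · obtain ⟨c, hc, h0, -⟩ := exists_slice_nat hlam (hnat 0) (hnat 0) (hnat 0)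
    exact ⟨c, hc, if_pos h0⟩
  · obtain ⟨a, ha, hp⟩ := hs _ (Ordinal.toZFSet_mem_toZFSet_iff.2 hξ)
    obtain ⟨c, hc, h0, h1, -⟩ := exists_slice_nat hlam (hnat 1) ha (hnat 0)
    refine ⟨c, hc, ?_⟩
    rw [if_neg (by rw [h0, nat_inj]; decide), h1]
    exact app_eq_of_isFunc hf hp

theorem lt_theta_iff {M : Set ZFSet.{u}} {A : ZFSet.{u}} (h : (surjOrdinals M A).Nonempty)
    {β : Ordinal.{u}} : β < theta M A ↔ ∃ γ ∈ surjOrdinals M A, β < γ :=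
  lt_csSup_iff (bddAbove_surjOrdinals M A) h

theorem isSuccLimit_theta (hlam : Order.IsSuccLimit lam) : Order.IsSuccLimit
    (theta (lClass (ZFSet.vonNeumann (lam + 1))) (ZFSet.vonNeumann (lam + 1))) := by
  have hne : (surjOrdinals (lClass (ZFSet.vonNeumann (lam + 1)))
    (ZFSet.vonNeumann (lam + 1))).Nonempty := ⟨1, one_mem_surjOrdinals⟩
  rw [Order.isSuccLimit_iff, Order.isSuccPrelimit_iff_succ_lt]
  refine ⟨fun h => ?_, fun β hβ => ?_⟩
  · have := (lt_theta_iff hne).2 ⟨1, one_mem_surjOrdinals, zero_lt_one⟩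
    exact h.not_lt this
  · obtain ⟨γ, hγ, hβγ⟩ := (lt_theta_iff hne).1 hβ
    exact (lt_theta_iff hne).2 ⟨γ + 1, add_one_mem_surjOrdinals hlam hγ,
      Order.lt_add_one_iff.2 (Order.succ_le_of_lt hβγ)⟩

theorem theta_notMem_surjOrdinals (hlam : Order.IsSuccLimit lam) :
    theta (lClass (ZFSet.vonNeumann (lam + 1))) (ZFSet.vonNeumann (lam + 1)) ∉
      surjOrdinals (lClass (ZFSet.vonNeumann (lam + 1))) (ZFSet.vonNeumann (lam + 1)) := fun h =>
  (Order.lt_add_one_iff.2 le_rfl).not_ge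
    (le_csSup (bddAbove_surjOrdinals _ _) (add_one_mem_surjOrdinals hlam h))

theorem regularIn_theta (hlam : Order.IsSuccLimit lam) :
    RegularIn (lClass (ZFSet.vonNeumann (lam + 1)))
      (theta (lClass (ZFSet.vonNeumann (lam + 1))) (ZFSet.vonNeumann (lam + 1))) := by
  refine ⟨isSuccLimit_theta hlam, ?_⟩
  rintro α hα ⟨f, hfM, hf, hcof⟩
  have hne : (surjOrdinals (lClass (ZFSet.vonNeumann (lam + 1)))
    (ZFSet.vonNeumann (lam + 1))).Nonempty := ⟨1, one_mem_surjOrdinals⟩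
  obtain ⟨α', ⟨e, heM, he, hes⟩, hαα'⟩ := (lt_theta_iff hne).1 hα
  have : InClass (lClass (ZFSet.vonNeumann (lam + 1))) f := ⟨hfM⟩
  have : InClass (lClass (ZFSet.vonNeumann (lam + 1))) e := ⟨heM⟩
  -- The three slices of the argument give an ordinal `ξ < α`, a choice among the surjections onto
  -- `f(ξ) + 1` that have the least possible index, and an argument for that surjection.
  refine theta_notMem_surjOrdinals hlam (mem_surjOrdinals_of_defFun InClass.mem
    (isSuccLimit_theta hlam).ne_bot
    (t := fun c => app (enum (ZFSet.vonNeumann (lam + 1)) (leastOrd fun x =>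
      ∃ b ∈ ZFSet.vonNeumann (lam + 1), IsSurjFunc (ZFSet.vonNeumann (lam + 1))
        (insert (app f (app e (slice c (nat 0)))) (app f (app e (slice c (nat 0)))))
        (enum (ZFSet.vonNeumann (lam + 1)) x b)) (slice c (nat 1))) (slice c (nat 2)))
    (by set_option synthInstance.maxSize 1000 in infer_instance) fun ζ hζ => ?_)
  obtain ⟨ξ, hξ, η, hζη, hp⟩ := hcof ζ hζ
  have hη := Ordinal.toZFSet_mem_toZFSet_iff.1 (ZFSet.pair_mem_prod.1 (hf.1 hp)).2
  obtain ⟨γ, hγ, hηγ⟩ := (lt_theta_iff hne).1 hη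
  obtain ⟨h, hhM, hh⟩ := mem_surjOrdinals_of_le InClass.mem hγ (β := η + 1) (by simp)
    (Order.add_one_le_of_lt hηγ)
  obtain ⟨δ, b, hb, rfl⟩ := isEnum_of_mem_lClass hlam hhM
  rw [Ordinal.toZFSet_add_one] at hh
  obtain ⟨b', hb', hs⟩ := leastOrd_spec (P := fun x => ∃ b ∈ ZFSet.vonNeumann (lam + 1),
    IsSurjFunc (ZFSet.vonNeumann (lam + 1)) (insert η.toZFSet η.toZFSet)
      (enum (ZFSet.vonNeumann (lam + 1)) x b)) ⟨b, hb, hh⟩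
  obtain ⟨a, ha, hpa⟩ := hes _ (Ordinal.toZFSet_mem_toZFSet_iff.2 (hξ.trans hαα'))
  obtain ⟨d, hd, hpd⟩ := hs.2 ζ.toZFSet (by
    rw [← Ordinal.toZFSet_add_one, Ordinal.toZFSet_mem_toZFSet_iff]
    exact Order.lt_add_one_iff.2 hζη)
  obtain ⟨c, hc, h0, h1, h2⟩ := exists_slice_nat hlam ha hb' hd
  refine ⟨c, hc, ?_⟩
  simp only [h0, h1, h2, app_eq_of_isFunc he hpa, app_eq_of_isFunc hf hp]
  exact app_eq_of_isFunc hs.1 hpd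

end Theta

/-! ### Dependent choice of length `λ` -/

section DC

variable {lam : Ordinal.{u}}

theorem dcIn_lClass (hlam : Order.IsSuccLimit lam) :
    DCIn (lClass (ZFSet.vonNeumann (lam + 1))) lam := by
  classical
  intro X hX F hFM hF
  have : InClass (lClass (ZFSet.vonNeumann (lam + 1))) F := ⟨hFM⟩
  -- the value at the parameter `a` of the first enumerated function that meets `F(s)`
  let next (s a : ZFSet.{u}) : ZFSet.{u} := enum (ZFSet.vonNeumann (lam + 1))
    (leastOrd fun x => ∃ a ∈ ZFSet.vonNeumann (lam + 1),
      enum (ZFSet.vonNeumann (lam + 1)) x a ∈ app F s) a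
  have hchoice : ∀ s, ∃ a ∈ ZFSet.vonNeumann (lam + 1),
      (app F s ⊆ X → app F s ≠ ∅ → next s a ∈ app F s) := by
    intro s
    by_cases h : app F s ⊆ X ∧ app F s ≠ ∅
    · obtain ⟨y, hy⟩ : ∃ y, y ∈ app F s := by
        by_contra! hne
        exact h.2 ((ZFSet.eq_empty _).2 hne)
      obtain ⟨δ, b, hb, hδ⟩ := isEnum_of_mem_lClass hlam (TransClass.trans hX (h.1 hy))
      obtain ⟨a, ha, hs⟩ := leastOrd_spec (P := fun x => ∃ a ∈ ZFSet.vonNeumann (lam + 1),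
        enum (ZFSet.vonNeumann (lam + 1)) x a ∈ app F s) ⟨b, hb, hδ ▸ hy⟩
      exact ⟨a, ha, fun _ _ => hs⟩
    · exact ⟨∅, mem_vonNeumann_add_one.2 (ZFSet.empty_subset _), fun h1 h2 => absurd ⟨h1, h2⟩ h⟩
  -- Choose parameters along the recursion in `V`, and code all of them by one `c ∈ V_{λ+1}`.
  choose ch hchV hch using hchoice
  let h : ZFSet.{u} → ZFSet.{u} := memRec (fun _ _ s => next s (ch s)) ∅
  obtain ⟨c, hcV, hc⟩ := exists_slice_eq hlam (I := lam.toZFSet)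
    (Ordinal.toZFSet_subset_vonNeumann lam) (fun x => ch (graphOn h x)) fun x _ => hchV _
  have hcM : InClass (lClass (ZFSet.vonNeumann (lam + 1))) c :=
    ⟨TransClass.trans (InClass.mem (c := ZFSet.vonNeumann (lam + 1))) hcV⟩
  -- From `c`, the same recursion can be carried out inside the model.
  let g : ZFSet.{u} → ZFSet.{u} := fun x => memRec (fun p x s => next s (slice p x)) c x
  have hg : DefFun (lClass (ZFSet.vonNeumann (lam + 1))) fun v : Fin 1 → ZFSet.{u} => g (v 0) := by
    dsimp only [g, next]
    infer_instance
  have hgh : ∀ x ∈ lam.toZFSet, g x = h x := by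
    intro x
    induction x using ZFSet.inductionOn with
    | h x ih =>
      intro hx
      have e : graphOn g x = graphOn h x := graphOn_congr fun y hy =>
        ih y hy ((ZFSet.isOrdinal_toZFSet lam).mem_trans hy hx)
      calc g x = next (graphOn g x) (slice c x) := memRec_eq _ _
        _ = next (graphOn h x) (ch (graphOn h x)) := by rw [e, hc x hx]
        _ = h x := (memRec_eq (G := fun _ _ s => next s (ch s)) ∅ x).symm
  have hsub : ∀ γ < lam, γ.toZFSet ⊆ lam.toZFSet := fun γ hγ =>
    Ordinal.toZFSet_subset_toZFSet_iff.2 hγ.le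
  have hmem : ∀ γ < lam, (∀ x ∈ γ.toZFSet, g x ∈ X) →
      ∃ Y, ZFSet.pair (graphOn g γ.toZFSet) Y ∈ F ∧ g γ.toZFSet ∈ Y ∧ Y ⊆ X := by
    intro γ hγ hX'
    have hs : graphOn g γ.toZFSet ∈ seqsBelow (lClass (ZFSet.vonNeumann (lam + 1))) lam X := by
      have hfun := isFunc_graphOn.2 hX'
      refine ZFSet.mem_sep.2 ⟨ZFSet.mem_powerset.2 fun p hp => ?_,
        graphOn_mem_class hg (toZFSet_mem_class γ), γ, hγ, hfun⟩
      obtain ⟨y, hy, rfl⟩ := mem_graphOn.1 hp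
      exact ZFSet.pair_mem_prod.2 ⟨hsub γ hγ hy, hX' y hy⟩
    have hp := pair_app_mem hF hs
    obtain ⟨hpow, -, hne⟩ := ZFSet.mem_sep.1 (ZFSet.pair_mem_prod.1 (hF.1 hp)).2
    have hYX := ZFSet.mem_powerset.1 hpow
    refine ⟨_, hp, ?_, hYX⟩
    have hγ' := Ordinal.toZFSet_mem_toZFSet_iff.2 hγ
    have e : graphOn g γ.toZFSet = graphOn h γ.toZFSet :=
      graphOn_congr fun y hy => hgh y (hsub γ hγ hy)
    have e' : g γ.toZFSet = next (graphOn g γ.toZFSet) (ch (graphOn g γ.toZFSet)) := by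
      rw [hgh _ hγ', e]
      exact memRec_eq (G := fun _ _ s => next s (ch s)) ∅ _
    rw [e']
    exact hch _ hYX hne
  have hgX : ∀ γ < lam, g γ.toZFSet ∈ X := by
    intro γ
    induction γ using WellFoundedLT.induction with
    | ind γ ih =>
      intro hγ
      obtain ⟨Y, -, hY, hYX⟩ := hmem γ hγ fun x hx => by
        obtain ⟨β, hβ, rfl⟩ := Ordinal.mem_toZFSet_iff.1 hx
        exact ih β hβ (hβ.trans hγ)
      exact hYX hY
  refine ⟨graphOn g lam.toZFSet, graphOn_mem_class hg (toZFSet_mem_class lam),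
    isFunc_graphOn.2 fun x hx => ?_, fun γ hγ => ?_⟩
  · obtain ⟨β, hβ, rfl⟩ := Ordinal.mem_toZFSet_iff.1 hx
    exact hgX β hβ
  · obtain ⟨Y, hY, hgY, -⟩ := hmem γ hγ fun x hx => by
      obtain ⟨β, hβ, rfl⟩ := Ordinal.mem_toZFSet_iff.1 hx
      exact hgX β (hβ.trans hγ)
    refine ⟨_, Y, pair_mem_graphOn.2 ⟨Ordinal.toZFSet_mem_toZFSet_iff.2 hγ, rfl⟩, ?_, hgY⟩
    rwa [restrict_graphOn (hsub γ hγ)]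

end DC

end RelConstr

theorem mainTheorem3 (lam : Ordinal.{u}) (hlam : Order.IsSuccLimit lam) :
    RelConstr.RegularIn (RelConstr.lClass (ZFSet.vonNeumann (lam + 1)))
        (RelConstr.theta (RelConstr.lClass (ZFSet.vonNeumann (lam + 1)))
          (ZFSet.vonNeumann (lam + 1))) ∧
      RelConstr.DCIn (RelConstr.lClass (ZFSet.vonNeumann (lam + 1))) lam :=
  ⟨RelConstr.regularIn_theta hlam, RelConstr.dcIn_lClass hlam⟩
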